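/- Let $\sigma:\mathbb{R}^2\to\mathbb{S}^2\subset\mathbb{R}^3$ be the inverse stereographic projection $$\sigma(w)=\left(\frac{|w|^2-1}{|w|^2+1},\ \frac{2w_1}{|w|^2+1},\ \frac{2w_2}{|w|^2+1}\right),\qquad w=(w_1,w_2)\in\mathbb{R}^2,$$ and let $J_0(x,y)=(-y,x)$ be the canonical complex structure of $\mathbb{R}^2$. Let $f,h\in H^1(\mathbb{R}^2)$ be real-valued, with weak gradients $\nabla f,\nabla h\in L^2(\mathbb{R}^2;\mathbb{R}^2)$. Then for each $i\in\{1,2,3\}$ the function $\sigma_i\langle J_0\nabla f,\nabla h\rangle$ is integrable on $\mathbb{R}^2$ and $$2\int_{\mathbb{R}^2}\sigma_i\,\langle J_0\nabla f,\nabla h\rangle\,dw\ \le\ \|\nabla f\|_{L^2(\mathbb{R}^2)}\,\|\nabla h\|_{L^2(\mathbb{R}^2)}.$$ Furthermore, for each $i\in\{1,2,3\}$, equality holds if and only if $f=0$ almost everywhere or $h=0$ almost everywhere. -/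

import Mathlib

open MeasureTheory
open scoped ContDiff RealInnerProductSpace

noncomputable section

/-- The Euclidean plane. -/
abbrev Plane : Type := EuclideanSpace ℝ (Fin 2)

/-- `G` is the weak (distributional) gradient of `f` on the plane: both are locally integrable
and `∫ f ∂ⱼφ = - ∫ Gⱼ φ` for all real test functions `φ` (smooth, compactly supported) and both
coordinate directions `j`. -/
structure IsWeakGradient (f : Plane → ℝ) (G : Plane → Plane) : Prop where
  locallyIntegrable_fun : LocallyIntegrable f volume
  locallyIntegrable_grad : LocallyIntegrable G volume
  integral_eq : ∀ φ : Plane → ℝ, ContDiff ℝ ∞ φ → HasCompactSupport φ → ∀ j : Fin 2,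
    ∫ w, f w * fderiv ℝ φ w (EuclideanSpace.single j 1) = - ∫ w, G w j * φ w

/-- The real Sobolev space `H¹` of the plane: square integrable functions with a square integrable
weak gradient. -/
def MemH1 (f : Plane → ℝ) : Prop :=
  MemLp f 2 volume ∧ ∃ G : Plane → Plane, IsWeakGradient f G ∧ MemLp G 2 volume

/-- The canonical complex structure of the plane, `(x, y) ↦ (-y, x)`. -/
def J₀ (v : Plane) : Plane := !₂[-v 1, v 0]

/-- Inverse stereographic projection from the plane to the unit sphere of `ℝ³`. -/
def stereoInv (w : Plane) : EuclideanSpace ℝ (Fin 3) :=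
  !₂[(‖w‖ ^ 2 - 1) / (‖w‖ ^ 2 + 1), 2 * w 0 / (‖w‖ ^ 2 + 1), 2 * w 1 / (‖w‖ ^ 2 + 1)]

/-- The `L²` norm of a vector field on the plane, as a real number. -/
def normL2 (G : Plane → Plane) : ℝ := (eLpNorm G 2 volume).toReal

end

/-! Regard u = f - i h as a function on the sphere. Poisson brackets with σ_{i+1} ± iσ_{i+2} and σ_i
give the raising, lowering and axial angular momenta L₊, L₋, L_z about the axis i. The area element
of the sphere is `sfac ^ 2` dw, so L² of the sphere is realized in L² of the plane by multiplying
with `sfac`; below, norms of u and of its angular momenta are taken on the sphere.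

Since σ is conformal, two identities hold pointwise (`angMom_norm_sq`): the squared lengths of the
angular momenta, suitably averaged, add up to |∇f|² + |∇h|², and their difference for L₊ and L₋ is
-4 σ_i ⟨J₀∇f, ∇h⟩. The commutator [L₊, L₋] = 2 L_z turns ‖L₊u‖² - ‖L₋u‖² into -2 Re⟨u, L_z u⟩
(`IsSphereRep.norm_sq_sub`). Together, ‖∇f‖² + ‖∇h‖² - 4 ∫ σ_i ⟨J₀∇f, ∇h⟩ = ‖L₊u‖² + Re⟨(L_z - 1)u,
L_z u⟩. The last term is ∑ k(k-1)‖u_k‖² over the weight components of u, and k(k-1) ≥ 0 because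
weights are integers (`IsSphereRep.re_inner_nonneg`).

Equality forces L₊u = 0 and leaves only the weights 0 and 1, hence u = α + c(σ_{i+1} + iσ_{i+2})
(`IsSphereRep.exists_eq_of_raising_eq_zero`). Such a function lies in L² of the flat plane only if
it vanishes (`eq_zero_of_memLp_two_xi`). Rescaling f by t and h by t⁻¹ passes from the sum of
squares to the product of norms.

The algebra is done on polynomials in x + iy, x - iy, t. It reaches weakly differentiable u because
the projections onto polynomials of bounded degree commute with the angular momenta
(`IsSphereRep.exists_approx`). -/

/-! ### Ladder operators on polynomials. -/

open MvPolynomial in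
/-- The values of the angular momentum operators on the generators `Z = x + iy`, `x - iy`, `t`. -/
noncomputable def ladderTable : Fin 3 → Fin 3 → MvPolynomial (Fin 3) ℂ :=
  ![![0, C 2 * X 2, - X 0], ![- (C 2 * X 2), 0, X 1], ![X 0, - X 1, 0]]

/-- The raising operator (`0`), the lowering operator (`1`) and the axial angular momentum (`2`) as
derivations of polynomials in `x + iy`, `x - iy`, `t`. -/
noncomputable def ladder (b : Fin 3) :
    Derivation ℂ (MvPolynomial (Fin 3) ℂ) (MvPolynomial (Fin 3) ℂ) :=
  MvPolynomial.mkDerivation ℂ (ladderTable b)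

/-- Formal adjoints: the raising and the lowering operators are exchanged. -/
def ladderAdj : Fin 3 → Fin 3 := ![1, 0, 2]

lemma ladder_X (b c : Fin 3) : ladder b (MvPolynomial.X c) = ladderTable b c := by
  simp [ladder]

/-- The only commutation relation of the rotation algebra that is needed. A commutator of
derivations is a derivation, so comparing the generators suffices. -/
lemma ladder_commutator (p : MvPolynomial (Fin 3) ℂ) :
    ladder 0 (ladder 1 p) - ladder 1 (ladder 0 p) = 2 • ladder 2 p := by
  have h : ⁅ladder 0, ladder 1⁆ = 2 • ladder 2 := by
    apply MvPolynomial.derivation_ext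
    intro i
    rw [Derivation.commutator_apply]
    simp only [Derivation.smul_apply, ladder_X]
    fin_cases i <;>
      simp [ladderTable, ladder_X, two_smul, MvPolynomial.C_mul']
  have := congrArg (fun D => D p) h
  simpa [Derivation.commutator_apply] using this

lemma ladder_two_monomial (m : Fin 3 →₀ ℕ) (c : ℂ) :
    ladder 2 (MvPolynomial.monomial m c)
      = (((m 0 : ℤ) - (m 1 : ℤ) : ℤ) : ℂ) • MvPolynomial.monomial m c := by
  have key : ∀ i : Fin 3, MvPolynomial.monomial (m - Finsupp.single i 1) (c * m i)
      * MvPolynomial.X i = (m i : ℂ) • MvPolynomial.monomial m c := by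
    intro i
    -- For `m i = 0` the truncated subtraction leaves a wrong exponent, but the coefficient `c * m
    -- i` is zero.
    by_cases hi : m i = 0
    · simp [hi]
    · have hm : m - Finsupp.single i 1 + Finsupp.single i 1 = m := by
        ext j
        by_cases hj : j = i
        · subst hj; simp; omega
        · simp [hj]
      rw [MvPolynomial.X, MvPolynomial.monomial_mul, MvPolynomial.smul_monomial, hm]
      congr 1
      simp [mul_comm]
  have h0 := key 0
  have h1 := key 1
  rw [ladder, MvPolynomial.mkDerivation_monomial, Finsupp.sum_fintype _ _ (by simp)]
  simp only [Fin.sum_univ_three, ladderTable]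
  simp only [smul_eq_mul, Matrix.cons_val, mul_neg, mul_zero, add_zero]
  rw [smul_add, smul_neg, ← smul_mul_assoc, ← smul_mul_assoc, MvPolynomial.smul_monomial,
    MvPolynomial.smul_monomial, smul_eq_mul, smul_eq_mul, h0, h1]
  push_cast
  rw [sub_smul, sub_eq_add_neg]

/-- Affine polynomials. -/
noncomputable def affinePoly : Submodule ℂ (MvPolynomial (Fin 3) ℂ) :=
  Submodule.span ℂ (Set.insert 1 (Set.range MvPolynomial.X))

/-- Having constants among the affine polynomials makes the powers `affinePoly ^ n` increasing: they
are the polynomials of degree at most `n`. -/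
lemma one_le_affinePoly : 1 ≤ affinePoly := by
  rw [Submodule.one_le]
  exact Submodule.subset_span (Or.inl rfl)

lemma X_mem_affinePoly (i : Fin 3) : MvPolynomial.X i ∈ affinePoly :=
  Submodule.subset_span (Or.inr ⟨i, rfl⟩)

lemma ladder_mem_affinePoly (b : Fin 3) {p : MvPolynomial (Fin 3) ℂ} (hp : p ∈ affinePoly) :
    ladder b p ∈ affinePoly := by
  induction hp using Submodule.span_induction with
  | mem x hx =>
    rcases hx with rfl | ⟨i, rfl⟩
    · simp
    · rw [ladder_X]
      have h2 : MvPolynomial.C 2 * MvPolynomial.X 2 ∈ affinePoly := by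
        rw [MvPolynomial.C_mul']
        exact Submodule.smul_mem _ _ (X_mem_affinePoly 2)
      fin_cases b <;> fin_cases i <;>
        simp [ladderTable, X_mem_affinePoly, h2]
  | zero => simp
  | add x y _ _ hx hy => rw [map_add]; exact add_mem hx hy
  | smul c x _ hx => rw [Derivation.map_smul]; exact Submodule.smul_mem _ _ hx

/-- The operators send generators to linear forms, so by the Leibniz rule they never raise the
degree. This gives finite-dimensional invariant subspaces. -/
lemma ladder_mem_affinePoly_pow (b : Fin 3) (n : ℕ) {p : MvPolynomial (Fin 3) ℂ}
    (hp : p ∈ affinePoly ^ n) : ladder b p ∈ affinePoly ^ n := by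
  induction n generalizing p with
  | zero =>
    rw [pow_zero, Submodule.mem_one] at hp
    obtain ⟨c, rfl⟩ := hp
    simp
  | succ n ih =>
    rw [pow_succ] at hp ⊢
    induction hp using Submodule.mul_induction_on' with
    | mem_mul_mem x hx y hy =>
      rw [Derivation.leibniz, smul_eq_mul, smul_eq_mul, mul_comm y]
      exact add_mem (Submodule.mul_mem_mul hx (ladder_mem_affinePoly b hy))
        (Submodule.mul_mem_mul (ih hx) hy)
    | add x _ y _ hx hy => rw [map_add]; exact add_mem hx hy

lemma affinePoly_pow_mono : Monotone fun n : ℕ => affinePoly ^ n :=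
  fun _ _ h => pow_le_pow_right₀ one_le_affinePoly h

lemma exists_mem_affinePoly_pow (p : MvPolynomial (Fin 3) ℂ) : ∃ n : ℕ, p ∈ affinePoly ^ n := by
  induction p using MvPolynomial.induction_on with
  | C a => exact ⟨0, by rw [pow_zero, Submodule.mem_one]; exact ⟨a, rfl⟩⟩
  | add p q hp hq =>
    obtain ⟨m, hm⟩ := hp
    obtain ⟨n, hn⟩ := hq
    exact ⟨max m n, add_mem (affinePoly_pow_mono (le_max_left _ _) hm)
      (affinePoly_pow_mono (le_max_right _ _) hn)⟩
  | mul_X p i hp =>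
    obtain ⟨n, hn⟩ := hp
    exact ⟨n + 1, by rw [pow_succ]; exact Submodule.mul_mem_mul hn (X_mem_affinePoly i)⟩

instance finiteDimensional_affinePoly_pow (n : ℕ) :
    FiniteDimensional ℂ ↥(affinePoly ^ n) := by
  apply Module.Finite.of_fg
  apply Submodule.FG.pow
  exact Submodule.fg_span (Set.Finite.insert _ (Set.finite_range _))

/-! ### Weak angular momenta in a Hilbert space, polynomial approximation and the commutator
identity. -/

section HilbertSpace

open scoped Topology

variable {H : Type*} [NormedAddCommGroup H] [InnerProductSpace ℂ H]

/-- A dense realization of the polynomials on the sphere in a Hilbert space. -/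
structure IsSphereRep (e : MvPolynomial (Fin 3) ℂ →ₗ[ℂ] H) : Prop where
  adj : ∀ b p q, inner ℂ (e (ladder b p)) (e q) = inner ℂ (e p) (e (ladder (ladderAdj b) q))
  sphere : ∀ p, e (MvPolynomial.X 0 * MvPolynomial.X 1 * p) = e p - e (MvPolynomial.X 2 ^ 2 * p)
  total : ∀ x : H, (∀ p, inner ℂ (e p) x = 0) → x = 0

/-- `a` is the angular momentum of `u` in the weak sense. -/
def IsWeakLadder (e : MvPolynomial (Fin 3) ℂ →ₗ[ℂ] H) (u : H) (a : Fin 3 → H) : Prop :=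
  ∀ b p, inner ℂ (e p) (a b) = inner ℂ (e (ladder (ladderAdj b) p)) u

variable {e : MvPolynomial (Fin 3) ℂ →ₗ[ℂ] H}

lemma ladderAdj_ladderAdj (b : Fin 3) : ladderAdj (ladderAdj b) = b := by
  fin_cases b <;> rfl

lemma IsSphereRep.isWeakLadder (he : IsSphereRep e) (q : MvPolynomial (Fin 3) ℂ) :
    IsWeakLadder e (e q) (fun b => e (ladder b q)) := by
  intro b p
  rw [he.adj, ladderAdj_ladderAdj]

lemma IsWeakLadder.add {u v : H} {a c : Fin 3 → H} (hu : IsWeakLadder e u a)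
    (hv : IsWeakLadder e v c) : IsWeakLadder e (u + v) (a + c) := by
  intro b p
  rw [Pi.add_apply, inner_add_right, inner_add_right, hu b p, hv b p]

lemma IsWeakLadder.smul {u : H} {a : Fin 3 → H} (hu : IsWeakLadder e u a) (z : ℂ) :
    IsWeakLadder e (z • u) (z • a) := by
  intro b p
  rw [Pi.smul_apply, inner_smul_right, inner_smul_right, hu b p]

/-- The polynomials of degree at most `n` in the Hilbert space. -/
noncomputable def polySpace (e : MvPolynomial (Fin 3) ℂ →ₗ[ℂ] H) (n : ℕ) : Submodule ℂ H :=
  (affinePoly ^ n).map e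

instance finiteDimensional_polySpace (n : ℕ) : FiniteDimensional ℂ (polySpace e n) := by
  unfold polySpace
  infer_instance

lemma polySpace_mono : Monotone (polySpace e) :=
  fun _ _ h => Submodule.map_mono (affinePoly_pow_mono h)

variable [CompleteSpace H]

lemma IsSphereRep.tendsto_starProjection (he : IsSphereRep e) (x : H) :
    Filter.Tendsto (fun n => (polySpace e n).starProjection x) Filter.atTop (𝓝 x) := by
  apply Submodule.starProjection_tendsto_self _ polySpace_mono
  rw [top_le_iff, ← Submodule.orthogonal_eq_bot_iff, Submodule.orthogonal_closure, eq_bot_iff]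
  intro y hy
  rw [Submodule.mem_bot]
  apply he.total
  intro p
  obtain ⟨n, hn⟩ := exists_mem_affinePoly_pow p
  exact hy _ (Submodule.mem_iSup_of_mem n (Submodule.mem_map_of_mem hn))

/-- Weak angular momenta are approximated by those of polynomials. -/
lemma IsSphereRep.exists_approx (he : IsSphereRep e) {u : H} {a : Fin 3 → H}
    (h : IsWeakLadder e u a) : ∃ q : ℕ → MvPolynomial (Fin 3) ℂ,
      Filter.Tendsto (fun n => e (q n)) Filter.atTop (𝓝 u) ∧
      ∀ b, Filter.Tendsto (fun n => e (ladder b (q n))) Filter.atTop (𝓝 (a b)) := by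
  have hex : ∀ n, ∃ q ∈ affinePoly ^ n, e q = (polySpace e n).starProjection u := fun n =>
    Submodule.starProjection_apply_mem (polySpace e n) u
  choose q hq hqu using hex
  refine ⟨q, ?_, fun b => ?_⟩
  · simpa only [hqu] using he.tendsto_starProjection u
  -- Projection and angular momentum commute, because the polynomials of degree at most `n` are
  -- stable under each operator and its adjoint: the operator applied to the projection of `u` is
  -- the projection of `a b`.
  · convert he.tendsto_starProjection (a b) using 2 with n
    symm
    apply Submodule.eq_starProjection_of_mem_of_inner_eq_zero
    · exact Submodule.mem_map_of_mem (ladder_mem_affinePoly_pow b n (hq n))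
    · rintro _ ⟨p, hp, rfl⟩
      have h1 := Submodule.starProjection_inner_eq_zero (K := polySpace e n) u
        (e (ladder (ladderAdj b) p))
        (Submodule.mem_map_of_mem (ladder_mem_affinePoly_pow (ladderAdj b) n hp))
      rw [← hqu, inner_sub_left, sub_eq_zero] at h1
      rw [inner_sub_left, sub_eq_zero, ← inner_conj_symm (a b), h b p, inner_conj_symm, h1,
        ← inner_conj_symm, ← inner_conj_symm (e (ladder b (q n))), he.isWeakLadder (q n) b p]

/-- On polynomials, ‖L₊q‖² - ‖L₋q‖² = ⟨q, (L₋L₊ - L₊L₋)q⟩ by adjointness, which the commutator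
reduces to L_z. The general case is a limit. -/
lemma IsSphereRep.norm_sq_sub (he : IsSphereRep e) {u : H} {a : Fin 3 → H}
    (h : IsWeakLadder e u a) :
    ‖a 0‖ ^ 2 - ‖a 1‖ ^ 2 = -2 * (inner ℂ u (a 2)).re := by
  obtain ⟨q, hq, hL⟩ := he.exists_approx h
  have h1 : Filter.Tendsto (fun n => ‖e (ladder 0 (q n))‖ ^ 2 - ‖e (ladder 1 (q n))‖ ^ 2)
      Filter.atTop (𝓝 (‖a 0‖ ^ 2 - ‖a 1‖ ^ 2)) := ((hL 0).norm.pow 2).sub ((hL 1).norm.pow 2)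
  have h2 : Filter.Tendsto (fun n => -2 * (inner ℂ (e (q n)) (e (ladder 2 (q n)))).re)
      Filter.atTop (𝓝 (-2 * (inner ℂ u (a 2)).re)) :=
    ((Complex.continuous_re.tendsto _).comp (hq.inner (hL 2))).const_mul _
  refine tendsto_nhds_unique h1 (h2.congr fun n => ?_)
  have e0 : ∀ b, ((‖e (ladder b (q n))‖ ^ 2 : ℝ)) =
      (inner ℂ (e (q n)) (e (ladder (ladderAdj b) (ladder b (q n))))).re := by
    intro b
    rw [← he.adj, ← inner_self_eq_norm_sq (𝕜 := ℂ)]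
    rfl
  rw [e0, e0]
  have hc := congrArg e (ladder_commutator (q n))
  rw [map_sub, map_nsmul] at hc
  have hc' := congrArg (fun x => (inner ℂ (e (q n)) x).re) hc
  simp only [inner_sub_right, Complex.sub_re, two_smul, inner_add_right, Complex.add_re] at hc'
  simp only [ladderAdj, Matrix.cons_val]
  linarith

end HilbertSpace

/-! ### Integer weights and positivity of the axial form. -/

section HilbertSpace

open scoped Topology

variable {H : Type*} [NormedAddCommGroup H] [InnerProductSpace ℂ H]
  {e : MvPolynomial (Fin 3) ℂ →ₗ[ℂ] H}

/-- Integrality of the weights is essential: k(k - 1) is negative for real k between 0 and 1. -/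
lemma int_mul_pred_nonneg (k : ℤ) : 0 ≤ (k - 1) * k := by
  rcases le_or_gt k 0 with h | h
  · exact mul_nonneg_of_nonpos_of_nonpos (by omega) h
  · exact mul_nonneg (by omega) (by omega)

/-- Integer weights: `∑ k (k - 1) ‖v_k‖² ≥ 0`. -/
lemma re_inner_weighted_sum_nonneg {ι : Type*} (s : Finset ι) (v : ι → H) (k : ι → ℤ)
    (hv : ∀ i j, k i ≠ k j → inner ℂ (v i) (v j) = 0) :
    0 ≤ (inner ℂ (∑ i ∈ s, ((k i : ℂ) - 1) • v i) (∑ i ∈ s, (k i : ℂ) • v i)).re := by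
  classical
  have hfib : ∀ g : ℤ → ℂ, ∑ i ∈ s, g (k i) • v i
      = ∑ κ ∈ s.image k, g κ • ∑ i ∈ s with k i = κ, v i := by
    intro g
    rw [← Finset.sum_fiberwise_of_maps_to (fun i hi => Finset.mem_image_of_mem k hi)]
    refine Finset.sum_congr rfl fun κ _ => ?_
    rw [Finset.smul_sum]
    exact Finset.sum_congr rfl fun i hi => by rw [(Finset.mem_filter.mp hi).2]
  have horth : ∀ κ κ' : ℤ, κ ≠ κ' →
      inner ℂ (∑ i ∈ s with k i = κ, v i) (∑ i ∈ s with k i = κ', v i) = 0 := by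
    intro κ κ' hne
    rw [sum_inner]
    refine Finset.sum_eq_zero fun i hi => ?_
    rw [inner_sum]
    refine Finset.sum_eq_zero fun j hj => hv i j ?_
    rw [(Finset.mem_filter.mp hi).2, (Finset.mem_filter.mp hj).2]
    exact hne
  rw [hfib (fun κ => (κ : ℂ) - 1), hfib (fun κ => (κ : ℂ)), sum_inner, Complex.re_sum]
  refine Finset.sum_nonneg fun κ hκ => ?_
  rw [inner_sum, Finset.sum_eq_single κ]
  · rw [inner_smul_left, inner_smul_right, inner_self_eq_norm_sq_to_K, ← mul_assoc]
    have : (starRingEnd ℂ) ((κ : ℂ) - 1) * κ = (((κ - 1) * κ : ℤ) : ℝ) := by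
      push_cast
      simp
    rw [this, ← Complex.coe_algebraMap, ← map_pow, ← map_mul, Complex.coe_algebraMap,
      Complex.ofReal_re]
    exact mul_nonneg (by exact_mod_cast int_mul_pred_nonneg κ) (by positivity)
  · intro κ' _ hne
    rw [inner_smul_left, inner_smul_right, horth κ κ' hne.symm, mul_zero, mul_zero]
  · exact fun h => absurd hκ h

/-- The weight of a monomial under the axial angular momentum. -/
def monoWeight (m : Fin 3 →₀ ℕ) : ℤ := (m 0 : ℤ) - (m 1 : ℤ)

/-- Monomials are eigenvectors of the symmetric operator L_z, and distinct eigenvalues give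
orthogonality. -/
lemma IsSphereRep.inner_monomial (he : IsSphereRep e) {m m' : Fin 3 →₀ ℕ} (c c' : ℂ)
    (h : monoWeight m ≠ monoWeight m') :
    inner ℂ (e (MvPolynomial.monomial m c)) (e (MvPolynomial.monomial m' c')) = 0 := by
  have h1 := he.adj 2 (MvPolynomial.monomial m c) (MvPolynomial.monomial m' c')
  have h2 : ladderAdj 2 = 2 := rfl
  rw [h2, ladder_two_monomial, ladder_two_monomial, map_smul, map_smul, inner_smul_left,
    inner_smul_right, ← sub_eq_zero, ← sub_mul, mul_eq_zero] at h1
  refine h1.resolve_left fun h3 => h ?_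
  rw [map_intCast, ← Int.cast_sub, Int.cast_eq_zero, sub_eq_zero] at h3
  exact h3

lemma IsSphereRep.re_inner_nonneg_poly (he : IsSphereRep e) (q : MvPolynomial (Fin 3) ℂ) :
    0 ≤ (inner ℂ (e (ladder 2 q) - e q) (e (ladder 2 q))).re := by
  have h1 : e q = ∑ m ∈ q.support, e (MvPolynomial.monomial m (q.coeff m)) := by
    conv_lhs => rw [q.as_sum, map_sum]
  have h2 : e (ladder 2 q) = ∑ m ∈ q.support,
      ((monoWeight m : ℤ) : ℂ) • e (MvPolynomial.monomial m (q.coeff m)) := by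
    conv_lhs => rw [q.as_sum, map_sum, map_sum]
    exact Finset.sum_congr rfl fun m _ => by rw [ladder_two_monomial, map_smul]; rfl
  have h3 : e (ladder 2 q) - e q = ∑ m ∈ q.support,
      (((monoWeight m : ℤ) : ℂ) - 1) • e (MvPolynomial.monomial m (q.coeff m)) := by
    rw [h1, h2, ← Finset.sum_sub_distrib]
    exact Finset.sum_congr rfl fun m _ => by rw [sub_smul, one_smul]
  rw [h3, h2]
  exact re_inner_weighted_sum_nonneg _ _ _ fun i j hij => he.inner_monomial _ _ hij

variable [CompleteSpace H]

lemma IsSphereRep.re_inner_nonneg (he : IsSphereRep e) {u : H} {a : Fin 3 → H}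
    (h : IsWeakLadder e u a) : 0 ≤ (inner ℂ (a 2 - u) (a 2)).re := by
  obtain ⟨q, hq, hL⟩ := he.exists_approx h
  have h2 := (Complex.continuous_re.tendsto _).comp (((hL 2).sub hq).inner (𝕜 := ℂ) (hL 2))
  exact ge_of_tendsto' h2 fun n => he.re_inner_nonneg_poly (q n)

/-- In the equality case all weights other than `0` and `1` vanish. -/
lemma IsSphereRep.inner_monomial_eq_zero (he : IsSphereRep e) {u : H} {a : Fin 3 → H}
    (h : IsWeakLadder e u a) (h0 : (inner ℂ (a 2 - u) (a 2)).re = 0) (m : Fin 3 →₀ ℕ)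
    (hm : (monoWeight m - 1) * monoWeight m ≠ 0) :
    inner ℂ (e (MvPolynomial.monomial m 1)) u = 0 := by
  set k : ℤ := monoWeight m with hk
  set v := e (MvPolynomial.monomial m 1) with hv
  have hLv : e (ladder 2 (MvPolynomial.monomial m 1)) = (k : ℂ) • v := by
    rw [ladder_two_monomial, map_smul]; rfl
  have hva : inner ℂ v (a 2) = (k : ℂ) * inner ℂ v u := by
    have h1 := h 2 (MvPolynomial.monomial m 1)
    have h2 : ladderAdj 2 = 2 := rfl
    rw [h2, hLv, inner_smul_left, map_intCast] at h1
    exact h1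
  have hav : inner ℂ (a 2) v = (k : ℂ) * inner ℂ u v := by
    rw [← inner_conj_symm, hva, map_mul, inner_conj_symm, map_intCast]
  -- A nonnegative quadratic form that vanishes at `u` has a vanishing first variation there. This
  -- is the form at `u + z • v`, where `v` has weight `k`.
  have key : ∀ z : ℂ, 0 ≤ 2 * (((k - 1) * k : ℤ) : ℝ) * (z * inner ℂ u v).re
      + (((k - 1) * k : ℤ) : ℝ) * (‖z‖ ^ 2 * ‖v‖ ^ 2) := by
    intro z
    have h3 := he.re_inner_nonneg (h.add ((he.isWeakLadder (MvPolynomial.monomial m 1)).smul z))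
    simp only [Pi.add_apply, Pi.smul_apply, hLv, ← hv] at h3
    have e1 : a 2 + z • (k : ℂ) • v - (u + z • v) = (a 2 - u) + (z * (k - 1)) • v := by
      module
    have e2 : inner ℂ v u = (starRingEnd ℂ) (inner ℂ u v) := (inner_conj_symm _ _).symm
    have e11 : inner ℂ v v = ((‖v‖ ^ 2 : ℝ) : ℂ) := by
      rw [inner_self_eq_norm_sq_to_K]
      push_cast
      rfl
    rw [e1, smul_smul, inner_add_left, inner_add_right, inner_add_right, inner_smul_left,
      inner_smul_right, inner_smul_left, inner_smul_right, hva, inner_sub_left (a 2) u v, hav,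
      Complex.add_re, Complex.add_re, h0, e2, e11] at h3
    have e3 : ‖z‖ ^ 2 = z.re ^ 2 + z.im ^ 2 := by
      rw [← Complex.normSq_eq_norm_sq, Complex.normSq_apply]; ring
    rw [e3]
    simp only [map_mul, Complex.mul_re, Complex.mul_im, Complex.add_re, Complex.sub_re,
      Complex.sub_im, Complex.conj_re, Complex.conj_im, Complex.intCast_re, Complex.intCast_im,
      Complex.one_re, Complex.one_im, Complex.ofReal_re,
      Complex.ofReal_im] at h3
    push_cast
    simp only [Complex.mul_re]
    refine h3.trans (le_of_eq ?_)
    ring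
  set A : ℝ := (((k - 1) * k : ℤ) : ℝ) with hA
  have hA0 : 0 < A := by
    have := int_mul_pred_nonneg k
    rw [hA]
    exact_mod_cast lt_of_le_of_ne this (Ne.symm hm)
  have huv : inner ℂ u v = 0 := by
    by_contra hne
    set c : ℂ := inner ℂ u v
    have hc : 0 < ‖c‖ ^ 2 := by positivity
    -- With `t * ‖v‖ ^ 2 ≤ 1` the quadratic term is at most half the size of the negative linear
    -- one.
    set t : ℝ := 1 / (1 + ‖v‖ ^ 2) with ht
    have htp : 0 < t := by positivity
    have h4 := key (-(t : ℂ) * (starRingEnd ℂ) c)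
    have e5 : (-(t : ℂ) * (starRingEnd ℂ) c * c).re = - t * ‖c‖ ^ 2 := by
      rw [mul_assoc, mul_comm ((starRingEnd ℂ) c), Complex.mul_conj, Complex.normSq_eq_norm_sq,
        ← Complex.ofReal_neg, ← Complex.ofReal_mul, Complex.ofReal_re]
    have e6 : ‖-(t : ℂ) * (starRingEnd ℂ) c‖ ^ 2 = t ^ 2 * ‖c‖ ^ 2 := by
      rw [norm_mul, norm_neg, RCLike.norm_conj, Complex.norm_real, mul_pow, Real.norm_eq_abs,
        sq_abs]
    rw [e5, e6] at h4
    have e7 : t * ‖v‖ ^ 2 ≤ 1 := by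
      rw [ht, one_div, inv_mul_le_iff₀ (by positivity)]
      linarith
    have e8 : t ^ 2 * ‖c‖ ^ 2 * ‖v‖ ^ 2 ≤ t * ‖c‖ ^ 2 := by
      have : t ^ 2 * ‖c‖ ^ 2 * ‖v‖ ^ 2 = t * ‖c‖ ^ 2 * (t * ‖v‖ ^ 2) := by ring
      rw [this]
      exact mul_le_of_le_one_right (by positivity) e7
    have e9 : A * (t ^ 2 * ‖c‖ ^ 2 * ‖v‖ ^ 2) ≤ A * (t * ‖c‖ ^ 2) :=
      mul_le_mul_of_nonneg_left e8 hA0.le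
    have e10 : 0 < A * (t * ‖c‖ ^ 2) := by positivity
    nlinarith
  rw [← inner_conj_symm, huv, map_zero]

end HilbertSpace

/-! ### Zero modes of the energy. -/

section HilbertSpace

open scoped Topology

variable {H : Type*} [NormedAddCommGroup H] [InnerProductSpace ℂ H]
  {e : MvPolynomial (Fin 3) ℂ →ₗ[ℂ] H}

lemma monomial_eq_smul_prod (m : Fin 3 →₀ ℕ) (c : ℂ) :
    (MvPolynomial.monomial m c : MvPolynomial (Fin 3) ℂ) =
      c • (MvPolynomial.X 0 ^ m 0 * MvPolynomial.X 1 ^ m 1 * MvPolynomial.X 2 ^ m 2) := by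
  rw [MvPolynomial.monomial_eq, Finsupp.prod_fintype _ _ (by simp), Fin.prod_univ_three,
    MvPolynomial.C_mul']

lemma ladder_one_pow_mul_pow (k j : ℕ) :
    ladder 1 (MvPolynomial.X 0 ^ (k + 1) * MvPolynomial.X 2 ^ (j + 1)) =
      (-(2 * ((k : ℂ) + 1))) • (MvPolynomial.X 0 ^ k * MvPolynomial.X 2 ^ (j + 2)) +
      ((j : ℂ) + 1) • (MvPolynomial.X 0 * MvPolynomial.X 1 *
        (MvPolynomial.X 0 ^ k * MvPolynomial.X 2 ^ j)) := by
  rw [Derivation.leibniz, Derivation.leibniz_pow, Derivation.leibniz_pow, ladder_X, ladder_X]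
  simp only [ladderTable, Matrix.cons_val, smul_eq_mul, nsmul_eq_mul, MvPolynomial.smul_eq_C_mul,
    Nat.add_sub_cancel, map_add, map_mul, map_neg, map_natCast, map_one]
  push_cast
  ring

lemma ladder_one_pow (k : ℕ) : ladder 1 (MvPolynomial.X 0 ^ (k + 1)) =
    (-(2 * ((k : ℂ) + 1))) • (MvPolynomial.X 0 ^ k * MvPolynomial.X 2) := by
  rw [Derivation.leibniz_pow, ladder_X]
  simp only [ladderTable, Matrix.cons_val, smul_eq_mul, nsmul_eq_mul, MvPolynomial.smul_eq_C_mul,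
    Nat.add_sub_cancel, map_add, map_mul, map_neg, map_natCast, map_one]
  push_cast
  ring

/-- Orthogonality to the range of L₋, with X₀X₁ = 1 - X₂², is a two-step recursion in `j`. The
coefficient -(2(k+1) + (j+1)) of its top term never vanishes, so the case `j = 0` determines all the
others. -/
lemma IsSphereRep.inner_pow_mul_pow_eq_zero (he : IsSphereRep e) {u : H}
    (hlow : ∀ p, inner ℂ (e (ladder 1 p)) u = 0) (k : ℕ)
    (hk : inner ℂ (e (MvPolynomial.X 0 ^ k)) u = 0) (j : ℕ) :
    inner ℂ (e (MvPolynomial.X 0 ^ k * MvPolynomial.X 2 ^ j)) u = 0 := by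
  have hk1 : ((2 * ((k : ℂ) + 1))) ≠ 0 := by
    exact_mod_cast (by omega : 2 * (k + 1) ≠ 0)
  induction j using Nat.strong_induction_on with
  | _ j ih =>
    match j with
    | 0 => simpa using hk
    | 1 =>
      have h := hlow (MvPolynomial.X 0 ^ (k + 1))
      rw [ladder_one_pow, map_smul, inner_smul_left, mul_eq_zero] at h
      rw [pow_one]
      refine h.resolve_left ?_
      exact (map_ne_zero _).mpr (neg_ne_zero.mpr hk1)
    | j + 2 =>
      have h := hlow (MvPolynomial.X 0 ^ (k + 1) * MvPolynomial.X 2 ^ (j + 1))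
      have h2 : (MvPolynomial.X 2 ^ 2 * (MvPolynomial.X 0 ^ k * MvPolynomial.X 2 ^ j) :
          MvPolynomial (Fin 3) ℂ) = MvPolynomial.X 0 ^ k * MvPolynomial.X 2 ^ (j + 2) := by ring
      rw [ladder_one_pow_mul_pow, map_add, map_smul, map_smul, he.sphere, h2, inner_add_left,
        inner_smul_left, inner_smul_left, inner_sub_left, ih j (by omega)] at h
      have h3 : (-(2 * ((k : ℂ) + 1)) - ((j : ℂ) + 1)) *
          inner ℂ (e (MvPolynomial.X 0 ^ k * MvPolynomial.X 2 ^ (j + 2))) u = 0 := by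
        simp only [map_neg, map_mul, map_add, map_one, map_natCast, map_ofNat] at h
        linear_combination h
      refine (mul_eq_zero.mp h3).resolve_left fun h4 => ?_
      have h5 : ((2 * (k + 1) + (j + 1) : ℕ) : ℂ) = 0 := by
        push_cast
        linear_combination -h4
      rw [Nat.cast_eq_zero] at h5
      omega

/-- A monomial of weight 0 or 1 is (X₀X₁)^b X₀^k X₂^c with k equal to that weight. The sphere
relation removes the factors X₀X₁ and the recursion for X₀^k X₂^j handles the rest; totality
concludes. -/
lemma IsSphereRep.eq_zero_of_lowering (he : IsSphereRep e) {u : H}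
    (hlow : ∀ p, inner ℂ (e (ladder 1 p)) u = 0)
    (hw : ∀ m : Fin 3 →₀ ℕ, (monoWeight m - 1) * monoWeight m ≠ 0 →
      inner ℂ (e (MvPolynomial.monomial m 1)) u = 0)
    (h1 : inner ℂ (e 1) u = 0) (hX : inner ℂ (e (MvPolynomial.X 0)) u = 0) : u = 0 := by
  have hdiag : ∀ k : ℕ, inner ℂ (e (MvPolynomial.X 0 ^ k)) u = 0 → ∀ b c : ℕ,
      inner ℂ (e (MvPolynomial.X 0 ^ (b + k) * MvPolynomial.X 1 ^ b * MvPolynomial.X 2 ^ c)) u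
        = 0 := by
    intro k hk b
    induction b with
    | zero => intro c; simpa using he.inner_pow_mul_pow_eq_zero hlow k hk c
    | succ b ih =>
      intro c
      have h2 : (MvPolynomial.X 0 ^ (b + 1 + k) * MvPolynomial.X 1 ^ (b + 1) *
          MvPolynomial.X 2 ^ c : MvPolynomial (Fin 3) ℂ) = MvPolynomial.X 0 * MvPolynomial.X 1 *
          (MvPolynomial.X 0 ^ (b + k) * MvPolynomial.X 1 ^ b * MvPolynomial.X 2 ^ c) := by ring
      have h3 : (MvPolynomial.X 2 ^ 2 * (MvPolynomial.X 0 ^ (b + k) * MvPolynomial.X 1 ^ b *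
          MvPolynomial.X 2 ^ c) : MvPolynomial (Fin 3) ℂ) = MvPolynomial.X 0 ^ (b + k) *
          MvPolynomial.X 1 ^ b * MvPolynomial.X 2 ^ (c + 2) := by ring
      rw [h2, he.sphere, h3, inner_sub_left, ih, ih, sub_zero]
  have hmono : ∀ m : Fin 3 →₀ ℕ, inner ℂ (e (MvPolynomial.monomial m 1)) u = 0 := by
    intro m
    by_cases hm : (monoWeight m - 1) * monoWeight m = 0
    · rw [monomial_eq_smul_prod, one_smul]
      rcases mul_eq_zero.mp hm with h | h
      · have h2 : m 0 = m 1 + 1 := by unfold monoWeight at h; omega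
        rw [h2]
        exact hdiag 1 (by rwa [pow_one]) _ _
      · have h2 : m 0 = m 1 + 0 := by unfold monoWeight at h; omega
        rw [h2]
        exact hdiag 0 (by rwa [pow_zero]) _ _
    · exact hw m hm
  apply he.total
  intro p
  rw [p.as_sum, map_sum, sum_inner]
  refine Finset.sum_eq_zero fun m _ => ?_
  rw [← mul_one (p.coeff m), ← smul_eq_mul, ← MvPolynomial.smul_monomial, map_smul,
    inner_smul_left, hmono, mul_zero]

variable [CompleteSpace H]

/-- Zero modes of the energy are spherical harmonics of degree `0` and of highest weight `1`. -/
lemma IsSphereRep.exists_eq_of_raising_eq_zero (he : IsSphereRep e) {u : H} {a : Fin 3 → H}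
    (h : IsWeakLadder e u a) (h0 : (inner ℂ (a 2 - u) (a 2)).re = 0) (ha : a 0 = 0) :
    ∃ α c : ℂ, u = e (MvPolynomial.C α + MvPolynomial.C c * MvPolynomial.X 0) := by
  -- The coefficient of the component of `u` along `e p`. As 1 and X₀ have different weights, both
  -- components can be subtracted independently.
  have hdef : ∀ p : MvPolynomial (Fin 3) ℂ, ∃ α : ℂ, inner ℂ (e p) (u - α • e p) = 0 := by
    intro p
    by_cases hp : e p = 0
    · exact ⟨0, by simp [hp]⟩
    · refine ⟨inner ℂ (e p) u / inner ℂ (e p) (e p), ?_⟩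
      rw [inner_sub_right, inner_smul_right, div_mul_cancel₀ _ (inner_self_ne_zero.mpr hp),
        sub_self]
  have mono1 : (1 : MvPolynomial (Fin 3) ℂ) = MvPolynomial.monomial 0 1 := rfl
  have monoX : (MvPolynomial.X 0 : MvPolynomial (Fin 3) ℂ) =
    MvPolynomial.monomial (Finsupp.single 0 1) 1 := rfl
  have w1 : monoWeight 0 = 0 := by simp [monoWeight]
  have wX : monoWeight (Finsupp.single 0 1) = 1 := by simp [monoWeight]
  have h1X : inner ℂ (e 1) (e (MvPolynomial.X 0)) = 0 := by
    rw [mono1, monoX]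
    exact he.inner_monomial _ _ (by rw [w1, wX]; decide)
  have hX1 : inner ℂ (e (MvPolynomial.X 0)) (e 1) = 0 := by
    rw [← inner_conj_symm, h1X, map_zero]
  obtain ⟨α, hα⟩ := hdef 1
  obtain ⟨c, hc⟩ := hdef (MvPolynomial.X 0)
  refine ⟨α, c, ?_⟩
  have heq : e (MvPolynomial.C α + MvPolynomial.C c * MvPolynomial.X 0) =
      α • e 1 + c • e (MvPolynomial.X 0) := by
    rw [← map_smul, ← map_smul, ← map_add, MvPolynomial.smul_eq_C_mul,
      MvPolynomial.smul_eq_C_mul, mul_one]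
  rw [heq, ← sub_eq_zero, ← sub_sub]
  -- The remainder is still killed by L₊, since 1 and X₀ are; weakly, this is orthogonality to the
  -- range of L₋.
  refine he.eq_zero_of_lowering ?_ ?_ ?_ ?_
  · intro p
    have hu := h 0 p
    have h11 := he.isWeakLadder 1 0 p
    have hXX := he.isWeakLadder (MvPolynomial.X 0) 0 p
    have hb : ladderAdj 0 = 1 := rfl
    have ht : ladderTable 0 0 = 0 := rfl
    simp only [hb, ha, ladder_X, ht, Derivation.map_one_eq_zero, map_zero, inner_zero_right]
      at hu h11 hXX
    rw [inner_sub_right, inner_sub_right, inner_smul_right, inner_smul_right, ← hu, ← h11, ← hXX]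
    simp
  · intro m hm
    rw [inner_sub_right, inner_sub_right, inner_smul_right, inner_smul_right,
      he.inner_monomial_eq_zero h h0 m hm, mono1, monoX, he.inner_monomial, he.inner_monomial]
    · simp
    · rw [wX]; rintro h2; rw [h2] at hm; simp at hm
    · rw [w1]; rintro h2; rw [h2] at hm; simp at hm
  · rw [inner_sub_right, hα, inner_smul_right, h1X, mul_zero, sub_zero]
  · rw [sub_right_comm, inner_sub_right, hc, inner_smul_right, hX1, mul_zero, sub_zero]

end HilbertSpace

/-! ### Calculus of the inverse stereographic projection. -/

/-- Partial derivatives of functions on the plane. -/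
noncomputable def pd {E : Type*} [NormedAddCommGroup E] [NormedSpace ℝ E] (j : Fin 2)
    (F : Plane → E) (w : Plane) : E :=
  fderiv ℝ F w (EuclideanSpace.single j 1)

/-- The conformal factor of the stereographic projection. -/
noncomputable def sfac (w : Plane) : ℝ := 2 / (‖w‖ ^ 2 + 1)

/-- The partial derivative in direction `j` of the component `a` of `stereoInv`. -/
noncomputable def dstereo (a : Fin 3) (j : Fin 2) (w : Plane) : ℝ :=
  ![sfac w ^ 2 * w j, sfac w * (if j = 0 then 1 else 0) - sfac w ^ 2 * w j * w 0,
    sfac w * (if j = 1 then 1 else 0) - sfac w ^ 2 * w j * w 1] a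

lemma sfac_pos (w : Plane) : 0 < sfac w := by unfold sfac; positivity

lemma plane_norm_sq (w : Plane) : ‖w‖ ^ 2 = w 0 ^ 2 + w 1 ^ 2 := by
  rw [EuclideanSpace.real_norm_sq_eq, Fin.sum_univ_two]

lemma sfac_mul (w : Plane) : sfac w * (w 0 ^ 2 + w 1 ^ 2) = 2 - sfac w := by
  rw [← plane_norm_sq]
  unfold sfac
  have : ‖w‖ ^ 2 + 1 ≠ 0 := by positivity
  field_simp
  ring

lemma stereoInv_zero (w : Plane) : stereoInv w 0 = 1 - sfac w := by
  have : ‖w‖ ^ 2 + 1 ≠ 0 := by positivity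
  simp only [stereoInv, sfac]
  simp
  field_simp
  ring

lemma stereoInv_one (w : Plane) : stereoInv w 1 = sfac w * w 0 := by
  simp [stereoInv, sfac]
  ring

lemma stereoInv_two (w : Plane) : stereoInv w 2 = sfac w * w 1 := by
  simp [stereoInv, sfac]
  ring

lemma contDiff_sfac : ContDiff ℝ ∞ sfac := by
  unfold sfac
  exact contDiff_const.div ((contDiff_norm_sq ℝ).add contDiff_const) fun w => by positivity

lemma contDiff_coord (l : Fin 2) : ContDiff ℝ ∞ fun w : Plane => w l :=
  (EuclideanSpace.proj (𝕜 := ℝ) l : Plane →L[ℝ] ℝ).contDiff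

lemma contDiff_stereoInv (a : Fin 3) : ContDiff ℝ ∞ fun w => stereoInv w a := by
  fin_cases a
  · simp only [Fin.zero_eta, stereoInv_zero]
    exact contDiff_const.sub contDiff_sfac
  · simp only [Fin.mk_one, stereoInv_one]
    exact contDiff_sfac.mul (contDiff_coord 0)
  · simp only [Fin.reduceFinMk, stereoInv_two]
    exact contDiff_sfac.mul (contDiff_coord 1)

section pd

variable {𝔸 : Type*} [NormedRing 𝔸] [NormedAlgebra ℝ 𝔸]

lemma pd_const (j : Fin 2) (c : 𝔸) (w : Plane) : pd j (fun _ => c) w = 0 := by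
  simp [pd]

lemma pd_add (j : Fin 2) {F G : Plane → 𝔸} {w : Plane} (hF : DifferentiableAt ℝ F w)
    (hG : DifferentiableAt ℝ G w) : pd j (fun w => F w + G w) w = pd j F w + pd j G w := by
  unfold pd
  rw [fderiv_fun_add hF hG, add_apply]

lemma pd_sub (j : Fin 2) {F G : Plane → 𝔸} {w : Plane} (hF : DifferentiableAt ℝ F w)
    (hG : DifferentiableAt ℝ G w) : pd j (fun w => F w - G w) w = pd j F w - pd j G w := by
  unfold pd
  rw [fderiv_fun_sub hF hG, sub_apply]

lemma pd_mul (j : Fin 2) {F G : Plane → 𝔸} {w : Plane} (hF : DifferentiableAt ℝ F w)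
    (hG : DifferentiableAt ℝ G w) :
    pd j (fun w => F w * G w) w = F w * pd j G w + pd j F w * G w := by
  unfold pd
  rw [fderiv_fun_mul' hF hG]
  simp

lemma pd_comp_clm {E F : Type*} [NormedAddCommGroup E] [NormedSpace ℝ E] [NormedAddCommGroup F]
    [NormedSpace ℝ F] (j : Fin 2) (L : E →L[ℝ] F) {G : Plane → E} {w : Plane}
    (hG : DifferentiableAt ℝ G w) : pd j (fun w => L (G w)) w = L (pd j G w) := by
  unfold pd
  have := (L.hasFDerivAt.comp w hG.hasFDerivAt).fderiv
  rw [Function.comp_def] at this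
  rw [this]
  rfl

end pd

lemma pd_coord (j l : Fin 2) (w : Plane) : pd j (fun w : Plane => w l) w = if j = l then 1 else 0 := by
  unfold pd
  have : HasFDerivAt (fun w : Plane => w l) (EuclideanSpace.proj (𝕜 := ℝ) l : Plane →L[ℝ] ℝ) w :=
    (EuclideanSpace.proj (𝕜 := ℝ) l : Plane →L[ℝ] ℝ).hasFDerivAt
  rw [this.fderiv]
  simp [eq_comm]

lemma pd_sfac (j : Fin 2) (w : Plane) : pd j sfac w = - (sfac w ^ 2 * w j) := by
  have h1 : HasFDerivAt (fun w : Plane => ‖w‖ ^ 2 + 1) (2 • (innerSL ℝ w)) w :=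
    (hasStrictFDerivAt_norm_sq w).hasFDerivAt.add_const 1
  have h0 : ‖w‖ ^ 2 + 1 ≠ 0 := by positivity
  have h2 := ((hasDerivAt_inv h0).const_mul 2).comp_hasFDerivAt w h1
  have h3 : sfac = (fun y => 2 * y⁻¹) ∘ (fun w : Plane => ‖w‖ ^ 2 + 1) := by
    ext w; simp [sfac, div_eq_mul_inv]
  unfold pd
  rw [h3, h2.fderiv]
  simp [EuclideanSpace.inner_single_right]
  field_simp

lemma pd_stereoInv (j : Fin 2) (a : Fin 3) (w : Plane) :
    pd j (fun w => stereoInv w a) w = dstereo a j w := by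
  have hs : DifferentiableAt ℝ sfac w := (contDiff_sfac.differentiable (by simp)) w
  have hc : ∀ l : Fin 2, DifferentiableAt ℝ (fun w : Plane => w l) w := fun l =>
    ((contDiff_coord l).differentiable (by simp)) w
  fin_cases a
  · simp only [Fin.zero_eta, stereoInv_zero, dstereo, Matrix.cons_val]
    rw [pd_sub j (differentiableAt_const _) hs, pd_const, pd_sfac]
    ring
  · simp only [Fin.mk_one, stereoInv_one, dstereo, Matrix.cons_val]
    rw [pd_mul j hs (hc 0), pd_coord, pd_sfac]
    ring
  · simp only [Fin.reduceFinMk, stereoInv_two, dstereo, Matrix.cons_val]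
    rw [pd_mul j hs (hc 1), pd_coord, pd_sfac]
    ring

/-- Componentwise form of ∂₀σ × ∂₁σ = -`sfac`² σ. Indices in `Fin 3` are cyclic, and the sign
reflects the orientation of this chart. -/
lemma dstereo_bracket (i : Fin 3) (w : Plane) :
    dstereo i 0 w * dstereo (i + 1) 1 w - dstereo i 1 w * dstereo (i + 1) 0 w
      = - sfac w ^ 2 * stereoInv w (i + 2) := by
  have h := sfac_mul w
  fin_cases i <;> simp [dstereo, stereoInv_zero, stereoInv_one, stereoInv_two]
  · ring
  · linear_combination (-sfac w ^ 2) * h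
  · ring

/-- Conformality of σ, the source of the energy identity and of the bound of all derivatives by
`sfac`. -/
lemma dstereo_conformal (l m : Fin 2) (w : Plane) :
    ∑ a, dstereo a l w * dstereo a m w = if l = m then sfac w ^ 2 else 0 := by
  have h := sfac_mul w
  rw [Fin.sum_univ_three]
  fin_cases l <;> fin_cases m <;> simp [dstereo]
  · linear_combination (sfac w ^ 3 * w 0 ^ 2) * h
  · linear_combination (sfac w ^ 3 * w 0 * w 1) * h
  · linear_combination (sfac w ^ 3 * w 0 * w 1) * h
  · linear_combination (sfac w ^ 3 * w 1 ^ 2) * h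

lemma abs_dstereo_le (a : Fin 3) (j : Fin 2) (w : Plane) : |dstereo a j w| ≤ sfac w := by
  have h := dstereo_conformal j j w
  rw [if_pos rfl] at h
  apply abs_le_of_sq_le_sq _ (sfac_pos w).le
  rw [← h]
  calc dstereo a j w ^ 2 = dstereo a j w * dstereo a j w := sq _
    _ ≤ _ := Finset.single_le_sum (f := fun a => dstereo a j w * dstereo a j w)
      (fun a _ => mul_self_nonneg _) (Finset.mem_univ a)

lemma stereoInv_sq_sum (w : Plane) : ∑ a, stereoInv w a ^ 2 = 1 := by
  have h := sfac_mul w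
  rw [Fin.sum_univ_three, stereoInv_zero, stereoInv_one, stereoInv_two]
  linear_combination sfac w * h

lemma abs_stereoInv_le (a : Fin 3) (w : Plane) : |stereoInv w a| ≤ 1 := by
  apply abs_le_of_sq_le_sq _ zero_le_one
  rw [one_pow, ← stereoInv_sq_sum w]
  exact Finset.single_le_sum (f := fun a => stereoInv w a ^ 2)
      (fun a _ => sq_nonneg _) (Finset.mem_univ a)

/-! ### Poisson brackets of polynomials on the sphere. -/

/-- The functions `x + iy`, `x - iy`, `t` on the sphere with axis `i`, in stereographic
coordinates. -/
noncomputable def xi (i b : Fin 3) (w : Plane) : ℂ :=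
  ![(stereoInv w (i + 1) : ℂ) + Complex.I * stereoInv w (i + 2),
    (stereoInv w (i + 1) : ℂ) - Complex.I * stereoInv w (i + 2), (stereoInv w i : ℂ)] b

/-- The partial derivatives of `xi`. -/
noncomputable def dxi (i b : Fin 3) (j : Fin 2) (w : Plane) : ℂ :=
  ![(dstereo (i + 1) j w : ℂ) + Complex.I * dstereo (i + 2) j w,
    (dstereo (i + 1) j w : ℂ) - Complex.I * dstereo (i + 2) j w, (dstereo i j w : ℂ)] b

/-- Evaluation of polynomials on the sphere in stereographic coordinates. -/
noncomputable def sphereEval (i : Fin 3) (w : Plane) : MvPolynomial (Fin 3) ℂ →ₐ[ℂ] ℂ :=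
  MvPolynomial.aeval fun b => xi i b w

/-- The Poisson bracket of functions on the plane. -/
noncomputable def bracket (F G : Plane → ℂ) (w : Plane) : ℂ :=
  pd 0 F w * pd 1 G w - pd 1 F w * pd 0 G w

lemma contDiff_ofReal_stereoInv (a : Fin 3) : ContDiff ℝ ∞ fun w => (stereoInv w a : ℂ) :=
  Complex.ofRealCLM.contDiff.comp (contDiff_stereoInv a)

lemma contDiff_xi (i b : Fin 3) : ContDiff ℝ ∞ (xi i b) := by
  have h := contDiff_ofReal_stereoInv
  fin_cases b
  · exact (h (i + 1)).add (contDiff_const.mul (h (i + 2)))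
  · exact (h (i + 1)).sub (contDiff_const.mul (h (i + 2)))
  · exact h i

lemma ContDiff.differentiableAt_plane {E : Type*} [NormedAddCommGroup E] [NormedSpace ℝ E]
    {F : Plane → E} (h : ContDiff ℝ ∞ F) (w : Plane) : DifferentiableAt ℝ F w :=
  (h.differentiable (by simp)) w

lemma pd_ofReal_stereoInv (j : Fin 2) (a : Fin 3) (w : Plane) :
    pd j (fun w => (stereoInv w a : ℂ)) w = dstereo a j w := by
  have := pd_comp_clm j Complex.ofRealCLM ((contDiff_stereoInv a).differentiableAt_plane w)
  rw [pd_stereoInv] at this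
  exact this

lemma pd_xi (i b : Fin 3) (j : Fin 2) (w : Plane) : pd j (xi i b) w = dxi i b j w := by
  have h : ∀ a, DifferentiableAt ℝ (fun w => (stereoInv w a : ℂ)) w := fun a =>
    (contDiff_ofReal_stereoInv a).differentiableAt_plane w
  have hm : pd j (fun w => Complex.I * (stereoInv w (i + 2) : ℂ)) w
      = Complex.I * dstereo (i + 2) j w := by
    rw [pd_mul j (differentiableAt_const _) (h _), pd_const, pd_ofReal_stereoInv, zero_mul,
      add_zero]
  have hd : DifferentiableAt ℝ (fun w => Complex.I * (stereoInv w (i + 2) : ℂ)) w :=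
    (differentiableAt_const _).mul (h _)
  fin_cases b
  · change pd j (fun w => (stereoInv w (i + 1) : ℂ) + Complex.I * stereoInv w (i + 2)) w = _
    rw [pd_add j (h _) hd, hm, pd_ofReal_stereoInv]
    rfl
  · change pd j (fun w => (stereoInv w (i + 1) : ℂ) - Complex.I * stereoInv w (i + 2)) w = _
    rw [pd_sub j (h _) hd, hm, pd_ofReal_stereoInv]
    rfl
  · exact pd_ofReal_stereoInv j i w

lemma fin_three_add (i : Fin 3) : i + 1 + 1 = i + 2 ∧ i + 1 + 2 = i ∧ i + 2 + 1 = i ∧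
    i + 2 + 2 = i + 1 := by
  fin_cases i <;> decide

lemma bracket_xi_xi (i b c : Fin 3) (w : Plane) : bracket (xi i b) (xi i c) w =
    Complex.I * (sfac w : ℂ) ^ 2 * sphereEval i w (ladderTable b c) := by
  obtain ⟨e1, e2, e3, e4⟩ := fin_three_add i
  have h1 := congrArg (fun x : ℝ => (x : ℂ)) (dstereo_bracket i w)
  have h2 := congrArg (fun x : ℝ => (x : ℂ)) (dstereo_bracket (i + 1) w)
  have h3 := congrArg (fun x : ℝ => (x : ℂ)) (dstereo_bracket (i + 2) w)
  rw [e1, e2] at h2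
  rw [e3, e4] at h3
  push_cast at h1 h2 h3
  have hI := Complex.I_sq
  unfold bracket
  simp only [pd_xi]
  fin_cases b <;> fin_cases c <;>
    simp [dxi, ladderTable, sphereEval, xi]
  · ring
  · linear_combination (-2 * Complex.I) * h2
  · linear_combination (-1 : ℂ) * h1 + Complex.I * h3 + (sfac w : ℂ) ^ 2 * (stereoInv w (i + 2)) * hI
  · linear_combination (2 * Complex.I) * h2
  · ring
  · linear_combination (-1 : ℂ) * h1 - Complex.I * h3 + (sfac w : ℂ) ^ 2 * (stereoInv w (i + 2)) * hI
  · linear_combination h1 - Complex.I * h3 - (sfac w : ℂ) ^ 2 * (stereoInv w (i + 2)) * hI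
  · linear_combination h1 + Complex.I * h3 - (sfac w : ℂ) ^ 2 * (stereoInv w (i + 2)) * hI
  · ring

lemma sphereEval_X (i b : Fin 3) (w : Plane) : sphereEval i w (MvPolynomial.X b) = xi i b w := by
  simp [sphereEval]

lemma sphereEval_C (i : Fin 3) (c : ℂ) (w : Plane) : sphereEval i w (MvPolynomial.C c) = c := by
  simp [sphereEval]

lemma contDiff_sphereEval (i : Fin 3) (p : MvPolynomial (Fin 3) ℂ) :
    ContDiff ℝ ∞ fun w => sphereEval i w p := by
  induction p using MvPolynomial.induction_on with
  | C a => simp only [sphereEval_C]; exact contDiff_const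
  | add p q hp hq => simp only [map_add]; exact hp.add hq
  | mul_X p b hp => simp only [map_mul, sphereEval_X]; exact hp.mul (contDiff_xi i b)

/-- Both sides obey the Leibniz rule in `p`, so the brackets of generators decide. This identifies
the formal operators with differential operators on the plane. -/
lemma bracket_xi_sphereEval (i b : Fin 3) (p : MvPolynomial (Fin 3) ℂ) (w : Plane) :
    bracket (xi i b) (fun w => sphereEval i w p) w =
      Complex.I * (sfac w : ℂ) ^ 2 * sphereEval i w (ladder b p) := by
  have hd : ∀ p : MvPolynomial (Fin 3) ℂ, DifferentiableAt ℝ (fun w => sphereEval i w p) w :=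
    fun p => (contDiff_sphereEval i p).differentiableAt_plane w
  induction p using MvPolynomial.induction_on with
  | C a => simp [bracket, pd_const]
  | add p q hp hq =>
    simp only [bracket, map_add] at hp hq ⊢
    rw [pd_add _ (hd p) (hd q), pd_add _ (hd p) (hd q)]
    linear_combination hp + hq
  | mul_X p c hp =>
    have hx := bracket_xi_xi i b c w
    have hdx : DifferentiableAt ℝ (xi i c) w := (contDiff_xi i c).differentiableAt_plane w
    rw [Derivation.leibniz, ladder_X, smul_eq_mul, smul_eq_mul]
    simp only [bracket, map_mul, map_add, sphereEval_X] at hp hx ⊢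
    rw [pd_mul _ (hd p) hdx, pd_mul _ (hd p) hdx]
    linear_combination (xi i c w) * hp + (sphereEval i w p) * hx

lemma sphereEval_sphere (i : Fin 3) (w : Plane) (p : MvPolynomial (Fin 3) ℂ) :
    sphereEval i w (MvPolynomial.X 0 * MvPolynomial.X 1 * p) =
      sphereEval i w p - sphereEval i w (MvPolynomial.X 2 ^ 2 * p) := by
  have h := congrArg (fun x : ℝ => (x : ℂ)) (stereoInv_sq_sum w)
  have h' : (stereoInv w i : ℂ) ^ 2 + (stereoInv w (i + 1) : ℂ) ^ 2
      + (stereoInv w (i + 2) : ℂ) ^ 2 = 1 := by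
    rw [Fin.sum_univ_three] at h
    push_cast at h
    rw [← h]
    fin_cases i <;> simp <;> ring
  simp only [map_mul, map_pow, sphereEval_X, xi, Matrix.cons_val]
  linear_combination (sphereEval i w p) * h' - (sphereEval i w p) * (stereoInv w (i + 2) : ℂ) ^ 2 * Complex.I_sq

lemma conj_xi (i b : Fin 3) (w : Plane) :
    (starRingEnd ℂ) (xi i b w) = xi i (ladderAdj b) w := by
  fin_cases b <;> simp [xi, ladderAdj, sub_eq_add_neg]

lemma norm_xi_le (i b : Fin 3) (w : Plane) : ‖xi i b w‖ ≤ 2 := by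
  have h : ∀ a, ‖(stereoInv w a : ℂ)‖ ≤ 1 := fun a => by
    rw [Complex.norm_real]; exact abs_stereoInv_le a w
  have h' : ‖Complex.I * (stereoInv w (i + 2) : ℂ)‖ ≤ 1 := by
    rw [norm_mul, Complex.norm_I, one_mul]; exact h _
  fin_cases b
  · exact (norm_add_le _ _).trans (by linarith [h (i + 1)])
  · exact (norm_sub_le _ _).trans (by linarith [h (i + 1)])
  · exact (h i).trans (by norm_num)

lemma norm_dxi_le (i b : Fin 3) (j : Fin 2) (w : Plane) : ‖dxi i b j w‖ ≤ 2 * sfac w := by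
  have h : ∀ a, ‖(dstereo a j w : ℂ)‖ ≤ sfac w := fun a => by
    rw [Complex.norm_real]; exact abs_dstereo_le a j w
  have h' : ‖Complex.I * (dstereo (i + 2) j w : ℂ)‖ ≤ sfac w := by
    rw [norm_mul, Complex.norm_I, one_mul]; exact h _
  fin_cases b
  · exact (norm_add_le _ _).trans (by linarith [h (i + 1)])
  · exact (norm_sub_le _ _).trans (by linarith [h (i + 1)])
  · exact (h i).trans (by linarith [sfac_pos w])

/-- The decay of the derivatives is inherited from the coordinates by the product rule; it serves
the dominated convergence arguments at infinity. -/
lemma exists_bound_sphereEval (i : Fin 3) (p : MvPolynomial (Fin 3) ℂ) :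
    ∃ C : ℝ, 0 ≤ C ∧ ∀ w, ‖sphereEval i w p‖ ≤ C ∧
      ∀ j, ‖pd j (fun w => sphereEval i w p) w‖ ≤ C * sfac w := by
  have hd : ∀ (p : MvPolynomial (Fin 3) ℂ) (w : Plane),
      DifferentiableAt ℝ (fun w => sphereEval i w p) w :=
    fun p w => (contDiff_sphereEval i p).differentiableAt_plane w
  induction p using MvPolynomial.induction_on with
  | C a =>
    refine ⟨‖a‖, norm_nonneg _, fun w => ⟨by simp, fun j => ?_⟩⟩
    simp only [sphereEval_C, pd_const, norm_zero]
    have := sfac_pos w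
    positivity
  | add p q hp hq =>
    obtain ⟨C, hC0, hC⟩ := hp
    obtain ⟨D, hD0, hD⟩ := hq
    refine ⟨C + D, by positivity, fun w => ⟨?_, fun j => ?_⟩⟩
    · rw [map_add]
      exact (norm_add_le _ _).trans (add_le_add (hC w).1 (hD w).1)
    · simp only [map_add]
      rw [pd_add _ (hd p w) (hd q w), add_mul]
      exact (norm_add_le _ _).trans (add_le_add ((hC w).2 j) ((hD w).2 j))
  | mul_X p c hp =>
    obtain ⟨C, hC0, hC⟩ := hp
    have hdx : ∀ w, DifferentiableAt ℝ (xi i c) w :=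
      fun w => (contDiff_xi i c).differentiableAt_plane w
    refine ⟨C * 4, by positivity, fun w => ⟨?_, fun j => ?_⟩⟩
    · rw [map_mul, sphereEval_X, norm_mul]
      have := norm_xi_le i c w
      exact mul_le_mul (hC w).1 (by linarith) (norm_nonneg _) hC0
    · simp only [map_mul, sphereEval_X]
      rw [pd_mul _ (hd p w) (hdx w), pd_xi]
      have h1 : ‖sphereEval i w p * dxi i c j w‖ ≤ C * (2 * sfac w) := by
        rw [norm_mul]
        exact mul_le_mul (hC w).1 (norm_dxi_le i c j w) (norm_nonneg _) hC0
      have h2 : ‖pd j (fun w => sphereEval i w p) w * xi i c w‖ ≤ C * sfac w * 2 := by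
        rw [norm_mul]
        have := sfac_pos w
        exact mul_le_mul ((hC w).2 j) (norm_xi_le i c w) (norm_nonneg _) (by positivity)
      exact (norm_add_le _ _).trans (by linarith)

lemma pd_conj (j : Fin 2) {F : Plane → ℂ} {w : Plane} (hF : DifferentiableAt ℝ F w) :
    pd j (fun w => (starRingEnd ℂ) (F w)) w = (starRingEnd ℂ) (pd j F w) :=
  pd_comp_clm j (Complex.conjCLE : ℂ →L[ℝ] ℂ) hF

/-- Conjugation exchanges x ± iy and changes the sign of i. That sign cancels the one from
integration by parts, so the adjoint of an operator is the one named by `ladderAdj`. -/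
lemma bracket_xi_conj_sphereEval (i b : Fin 3) (p : MvPolynomial (Fin 3) ℂ) (w : Plane) :
    bracket (xi i b) (fun w => (starRingEnd ℂ) (sphereEval i w p)) w =
      - (Complex.I * (sfac w : ℂ) ^ 2 *
        (starRingEnd ℂ) (sphereEval i w (ladder (ladderAdj b) p))) := by
  have h := congrArg (starRingEnd ℂ) (bracket_xi_sphereEval i (ladderAdj b) p w)
  have hx : ∀ j, (starRingEnd ℂ) (pd j (xi i (ladderAdj b)) w) = pd j (xi i b) w := by
    intro j
    rw [← pd_conj j ((contDiff_xi i _).differentiableAt_plane w)]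
    congr 1
    ext w
    rw [conj_xi, ladderAdj_ladderAdj]
  have hp : ∀ j, (starRingEnd ℂ) (pd j (fun w => sphereEval i w p) w) =
      pd j (fun w => (starRingEnd ℂ) (sphereEval i w p)) w := fun j =>
    (pd_conj j ((contDiff_sphereEval i p).differentiableAt_plane w)).symm
  simp only [bracket, map_sub, map_mul, map_pow, hx, hp, Complex.conj_I, Complex.conj_ofReal] at h
  rw [bracket, h]
  ring

lemma exists_conj_sphereEval (i : Fin 3) (p : MvPolynomial (Fin 3) ℂ) :
    ∃ q, ∀ w, sphereEval i w q = (starRingEnd ℂ) (sphereEval i w p) := by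
  induction p using MvPolynomial.induction_on with
  | C a => exact ⟨MvPolynomial.C ((starRingEnd ℂ) a), fun w => by rw [sphereEval_C, sphereEval_C]⟩
  | add p q hp hq =>
    obtain ⟨p', hp'⟩ := hp
    obtain ⟨q', hq'⟩ := hq
    exact ⟨p' + q', fun w => by rw [map_add, map_add, map_add, hp', hq']⟩
  | mul_X p c hp =>
    obtain ⟨p', hp'⟩ := hp
    exact ⟨p' * MvPolynomial.X (ladderAdj c), fun w => by
      rw [map_mul, map_mul, map_mul, hp', sphereEval_X, sphereEval_X, conj_xi]⟩

/-! ### Weak gradients and integration by parts over the whole plane. -/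

/-- Complex-valued version of weak gradients on the plane. -/
structure IsWeakGradC (u : Plane → ℂ) (D : Fin 2 → Plane → ℂ) : Prop where
  locallyIntegrable_fun : LocallyIntegrable u volume
  locallyIntegrable_grad : ∀ j, LocallyIntegrable (D j) volume
  integral_eq : ∀ φ : Plane → ℂ, ContDiff ℝ ∞ φ → HasCompactSupport φ → ∀ j : Fin 2,
    ∫ w, u w * pd j φ w = - ∫ w, D j w * φ w

/-- The Poisson bracket of a smooth function with a weakly differentiable one. -/
noncomputable def weakBracket (τ : Plane → ℂ) (D : Fin 2 → Plane → ℂ) (w : Plane) : ℂ :=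
  pd 0 τ w * D 1 w - pd 1 τ w * D 0 w

lemma contDiff_pd {E : Type*} [NormedAddCommGroup E] [NormedSpace ℝ E] {F : Plane → E}
    (hF : ContDiff ℝ ∞ F) (j : Fin 2) : ContDiff ℝ ∞ (pd j F) :=
  (hF.fderiv_right (by simp)).clm_apply contDiff_const

lemma HasCompactSupport.pd_plane {E : Type*} [NormedAddCommGroup E] [NormedSpace ℝ E]
    {F : Plane → E} (hF : HasCompactSupport F) (j : Fin 2) : HasCompactSupport (pd j F) :=
  hF.fderiv_apply ℝ _

lemma pd_pd_comm {F : Plane → ℂ} (hF : ContDiff ℝ ∞ F) (w : Plane) :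
    pd 0 (pd 1 F) w = pd 1 (pd 0 F) w := by
  have hd : DifferentiableAt ℝ (fderiv ℝ F) w :=
    ((hF.fderiv_right (m := ∞) (by simp)).differentiable (by simp)) w
  have h : ∀ i j : Fin 2, pd i (pd j F) w =
      fderiv ℝ (fderiv ℝ F) w (EuclideanSpace.single i 1) (EuclideanSpace.single j 1) := by
    intro i j
    have := (hd.hasFDerivAt.clm_apply (hasFDerivAt_const (EuclideanSpace.single j (1 : ℝ)) w)).fderiv
    unfold pd
    rw [this]
    simp
  rw [h, h]
  exact (hF.contDiffAt.isSymmSndFDerivAt (by simpa using ENat.LEInfty.out)).eq _ _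

lemma MeasureTheory.LocallyIntegrable.integrable_mul_of_hasCompactSupport {u φ : Plane → ℂ}
    (hu : LocallyIntegrable u volume) (hφ : Continuous φ) (hc : HasCompactSupport φ) :
    Integrable (fun w => u w * φ w) volume := by
  have := hu.integrable_smul_left_of_hasCompactSupport hφ hc
  simpa [mul_comm] using this

/-- The test functions are ψ ∂ⱼτ; the second derivatives of τ cancel by symmetry and only a bracket
remains. -/
lemma IsWeakGradC.integral_weakBracket_of_hasCompactSupport {u : Plane → ℂ}
    {D : Fin 2 → Plane → ℂ} (h : IsWeakGradC u D) {τ ψ : Plane → ℂ} (hτ : ContDiff ℝ ∞ τ)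
    (hψ : ContDiff ℝ ∞ ψ) (hc : HasCompactSupport ψ) :
    ∫ w, ψ w * weakBracket τ D w = - ∫ w, u w * bracket τ ψ w := by
  have hs : ∀ j, ContDiff ℝ ∞ fun w => ψ w * pd j τ w := fun j => hψ.mul (contDiff_pd hτ j)
  have hcs : ∀ j, HasCompactSupport fun w => ψ w * pd j τ w := fun j => hc.mul_right
  have h1 := h.integral_eq _ (hs 0) (hcs 0) 1
  have h0 := h.integral_eq _ (hs 1) (hcs 1) 0
  have i1 : ∀ j k, Integrable (fun w => D j w * (ψ w * pd k τ w)) volume := fun j k =>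
    (h.locallyIntegrable_grad j).integrable_mul_of_hasCompactSupport (hs k).continuous (hcs k)
  have i2 : ∀ j k, Integrable (fun w => u w * pd j (fun w => ψ w * pd k τ w) w) volume :=
    fun j k => h.locallyIntegrable_fun.integrable_mul_of_hasCompactSupport
      (contDiff_pd (hs k) j).continuous ((hcs k).pd_plane j)
  have e1 : ∫ w, ψ w * weakBracket τ D w =
      ∫ w, (D 1 w * (ψ w * pd 0 τ w) - D 0 w * (ψ w * pd 1 τ w)) := by
    congr 1; ext w; unfold weakBracket; ring
  have e2 : ∫ w, u w * bracket τ ψ w = ∫ w, (u w * pd 1 (fun w => ψ w * pd 0 τ w) w -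
      u w * pd 0 (fun w => ψ w * pd 1 τ w) w) := by
    congr 1
    ext w
    have hψd := hψ.differentiableAt_plane w
    have hτd : ∀ j, DifferentiableAt ℝ (pd j τ) w := fun j =>
      (contDiff_pd hτ j).differentiableAt_plane w
    rw [pd_mul _ hψd (hτd 0), pd_mul _ hψd (hτd 1), pd_pd_comm hτ]
    unfold bracket
    ring
  rw [e1, e2, integral_sub (i1 1 0) (i1 0 1), integral_sub (i2 1 0) (i2 0 1), h1, h0]
  ring

/-- Dilates of one bump function. The gradient bound by (1 + ‖w‖)⁻¹ is uniform in `n` because ‖w‖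
|∇χ| is invariant under dilation. -/
lemma exists_cutoff : ∃ χ : ℕ → Plane → ℂ, (∀ n, ContDiff ℝ ∞ (χ n)) ∧
    (∀ n, HasCompactSupport (χ n)) ∧ (∀ n w, ‖χ n w‖ ≤ 1) ∧
    (∃ C : ℝ, 0 ≤ C ∧ ∀ n w j, ‖pd j (χ n) w‖ ≤ C * (1 + ‖w‖)⁻¹) ∧
    ∀ w, ∀ᶠ n in Filter.atTop, χ n w = 1 ∧ ∀ j, pd j (χ n) w = 0 := by
  let f : ContDiffBump (0 : Plane) := ⟨1, 2, one_pos, one_lt_two⟩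
  let F : Plane → ℂ := fun w => (f w : ℂ)
  have hF : ContDiff ℝ ∞ F := Complex.ofRealCLM.contDiff.comp f.contDiff
  have hFc : HasCompactSupport F := f.hasCompactSupport.comp_left (g := fun x : ℝ => (x : ℂ)) rfl
  have hr : ∀ n : ℕ, (0 : ℝ) < (n : ℝ) + 1 := fun n => by positivity
  let χ : ℕ → Plane → ℂ := fun n w => F (((n : ℝ) + 1)⁻¹ • w)
  have hpd : ∀ n w j, pd j (χ n) w = ((n : ℝ) + 1)⁻¹ • pd j F (((n : ℝ) + 1)⁻¹ • w) := by
    intro n w j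
    have h1 : HasFDerivAt (fun w : Plane => ((n : ℝ) + 1)⁻¹ • w)
        (((n : ℝ) + 1)⁻¹ • ContinuousLinearMap.id ℝ Plane) w :=
      (((n : ℝ) + 1)⁻¹ • ContinuousLinearMap.id ℝ Plane).hasFDerivAt
    have h2 := (hF.differentiableAt_plane (((n : ℝ) + 1)⁻¹ • w)).hasFDerivAt.comp w h1
    unfold pd
    rw [show χ n = F ∘ fun w : Plane => ((n : ℝ) + 1)⁻¹ • w from rfl, h2.fderiv]
    simp
  have hb : ∀ j, ∃ C, ∀ v : Plane, ‖(1 + ‖v‖) • pd j F v‖ ≤ C := fun j =>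
    ((continuous_const.add continuous_norm).smul
      (contDiff_pd hF j).continuous).bounded_above_of_compact_support (hFc.pd_plane j).smul_left
  choose C hC using hb
  have hC0 : ∀ j, 0 ≤ C j := fun j => (norm_nonneg _).trans (hC j 0)
  refine ⟨χ, fun n => hF.comp (contDiff_const_smul _), fun n => ?_, fun n w => ?_,
    ⟨C 0 + C 1, add_nonneg (hC0 0) (hC0 1), fun n w j => ?_⟩, fun w => ?_⟩
  · exact hFc.comp_smul (inv_ne_zero (hr n).ne')
  · change ‖((f _ : ℝ) : ℂ)‖ ≤ 1
    rw [Complex.norm_real, Real.norm_eq_abs, abs_of_nonneg f.nonneg]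
    exact f.le_one
  · have hj : C j ≤ C 0 + C 1 := by
      fin_cases j
      · simpa using hC0 1
      · simpa using hC0 0
    rw [hpd, norm_smul, ← div_eq_mul_inv, le_div_iff₀ (by positivity)]
    refine le_trans ?_ ((hC j (((n : ℝ) + 1)⁻¹ • w)).trans hj)
    rw [norm_smul, norm_smul, Real.norm_of_nonneg (inv_pos.mpr (hr n)).le,
      Real.norm_of_nonneg (by positivity), mul_right_comm]
    refine mul_le_mul_of_nonneg_right ?_ (norm_nonneg _)
    rw [mul_add, mul_one]
    gcongr
    exact inv_le_one_of_one_le₀ (by simp)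
  · obtain ⟨N, hN⟩ := exists_nat_gt ‖w‖
    filter_upwards [Filter.eventually_ge_atTop N] with n hn
    have hlt : ‖w‖ < (n : ℝ) + 1 := by
      have : (N : ℝ) ≤ n := by exact_mod_cast hn
      linarith
    have hone : ∀ v : Plane, ‖v‖ < (n : ℝ) + 1 → χ n v = 1 := by
      intro v hv
      change ((f _ : ℝ) : ℂ) = 1
      rw [f.one_of_mem_closedBall, Complex.ofReal_one]
      rw [mem_closedBall_zero_iff, norm_smul, Real.norm_of_nonneg (inv_pos.mpr (hr n)).le,
        inv_mul_le_iff₀ (hr n)]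
      change ‖v‖ ≤ ((n : ℝ) + 1) * 1
      linarith
    refine ⟨hone w hlt, fun j => ?_⟩
    have hev : χ n =ᶠ[nhds w] fun _ => 1 := by
      filter_upwards [(isOpen_lt continuous_norm continuous_const).mem_nhds hlt] with v hv
      exact hone v hv
    unfold pd
    rw [hev.fderiv_eq]
    simp

lemma sfac_le (w : Plane) : sfac w ≤ 4 * ((1 + ‖w‖)⁻¹) ^ 2 := by
  unfold sfac
  rw [inv_pow, ← div_eq_mul_inv, div_le_div_iff₀ (by positivity) (by positivity)]
  nlinarith [sq_nonneg (‖w‖ - 1)]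

lemma norm_bracket_le {F G : Plane → ℂ} {w : Plane} {A B : ℝ} (hA : 0 ≤ A)
    (hF : ∀ j, ‖pd j F w‖ ≤ A) (hG : ∀ j, ‖pd j G w‖ ≤ B) : ‖bracket F G w‖ ≤ 2 * (A * B) := by
  unfold bracket
  refine (norm_sub_le _ _).trans ?_
  rw [norm_mul, norm_mul]
  have h0 := mul_le_mul (hF 0) (hG 1) (norm_nonneg _) hA
  have h1 := mul_le_mul (hF 1) (hG 0) (norm_nonneg _) hA
  linarith

/-- Compact support is removed by cutoffs. The weight `sfac w * (1 + ‖w‖)⁻¹` on `u` is what the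
cutoff gradient costs; it decays like ‖w‖⁻³, so bounded `u` are admitted as well as square
integrable ones. -/
lemma IsWeakGradC.integral_weakBracket {u : Plane → ℂ} {D : Fin 2 → Plane → ℂ}
    (h : IsWeakGradC u D) {τ g : Plane → ℂ} (hτ : ContDiff ℝ ∞ τ) (hg : ContDiff ℝ ∞ g) {A B : ℝ}
    (hA : 0 ≤ A) (hB : 0 ≤ B)
    (hτb : ∀ w j, ‖pd j τ w‖ ≤ A * sfac w) (hgb : ∀ w, ‖g w‖ ≤ B)
    (hgb' : ∀ w j, ‖pd j g w‖ ≤ B * sfac w)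
    (hu : Integrable (fun w => (sfac w * (1 + ‖w‖)⁻¹) • u w) volume)
    (hD : ∀ j, Integrable (fun w => sfac w • D j w) volume) :
    ∫ w, g w * weakBracket τ D w = - ∫ w, u w * bracket τ g w := by
  obtain ⟨χ, hχ, hχc, hχ1, ⟨C, hC0, hC⟩, hχlim⟩ := exists_cutoff
  have hprod : ∀ n w, bracket τ (fun w => χ n w * g w) w =
      χ n w * bracket τ g w + bracket τ (χ n) w * g w := by
    intro n w
    unfold bracket
    rw [pd_mul _ ((hχ n).differentiableAt_plane w) (hg.differentiableAt_plane w),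
      pd_mul _ ((hχ n).differentiableAt_plane w) (hg.differentiableAt_plane w)]
    ring
  have key : ∀ n, ∫ w, χ n w * g w * weakBracket τ D w =
      - ∫ w, u w * bracket τ (fun w => χ n w * g w) w := fun n =>
    h.integral_weakBracket_of_hasCompactSupport hτ ((hχ n).mul hg) (hχc n).mul_right
  have hk : ∀ w : Plane, 0 < (1 + ‖w‖)⁻¹ := fun w => by positivity
  have hτc : ∀ j, Continuous (pd j τ) := fun j => (contDiff_pd hτ j).continuous
  have hwm : AEStronglyMeasurable (weakBracket τ D) volume :=
    ((hτc 0).aestronglyMeasurable.mul (h.locallyIntegrable_grad 1).aestronglyMeasurable).sub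
      ((hτc 1).aestronglyMeasurable.mul (h.locallyIntegrable_grad 0).aestronglyMeasurable)
  have hbc : ∀ {G : Plane → ℂ}, ContDiff ℝ ∞ G → Continuous (bracket τ G) := fun hG =>
    ((hτc 0).mul (contDiff_pd hG 1).continuous).sub ((hτc 1).mul (contDiff_pd hG 0).continuous)
  have l1 : Filter.Tendsto (fun n => ∫ w, χ n w * g w * weakBracket τ D w) Filter.atTop
      (nhds (∫ w, g w * weakBracket τ D w)) := by
    refine tendsto_integral_of_dominated_convergence
      (fun w => B * A * ‖sfac w • D 1 w‖ + B * A * ‖sfac w • D 0 w‖) (fun n => ?_) ?_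
      (fun n => Filter.Eventually.of_forall fun w => ?_) (Filter.Eventually.of_forall fun w => ?_)
    · exact ((hχ n).continuous.mul hg.continuous).aestronglyMeasurable.mul hwm
    · exact ((hD 1).norm.const_mul _).add ((hD 0).norm.const_mul _)
    · have h1 : ∀ j k, ‖pd j τ w * D k w‖ ≤ A * ‖sfac w • D k w‖ := by
        intro j k
        rw [norm_mul, norm_smul, Real.norm_of_nonneg (sfac_pos w).le, ← mul_assoc]
        exact mul_le_mul_of_nonneg_right (hτb w j) (norm_nonneg _)
      have h2 : ‖weakBracket τ D w‖ ≤ A * ‖sfac w • D 1 w‖ + A * ‖sfac w • D 0 w‖ :=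
        (norm_sub_le _ _).trans (add_le_add (h1 0 1) (h1 1 0))
      have h3 : ‖χ n w * g w‖ ≤ B := by
        rw [norm_mul]
        exact (mul_le_mul (hχ1 n w) (hgb w) (norm_nonneg _) zero_le_one).trans (by rw [one_mul])
      rw [norm_mul]
      exact (mul_le_mul h3 h2 (norm_nonneg _) hB).trans (le_of_eq (by ring))
    · refine tendsto_const_nhds.congr' ?_
      filter_upwards [hχlim w] with n hn
      rw [hn.1, one_mul]
  -- In the dominating constant, 8 is 2 from the two terms of a bracket times 4 from `sfac w ≤ 4 *
  -- (1 + ‖w‖)⁻¹`; the second summand bounds the bracket with the cutoff.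
  have l2 : Filter.Tendsto (fun n => ∫ w, u w * bracket τ (fun w => χ n w * g w) w) Filter.atTop
      (nhds (∫ w, u w * bracket τ g w)) := by
    refine tendsto_integral_of_dominated_convergence
      (fun w => (8 * (A * B) + 2 * (A * C) * B) * ‖(sfac w * (1 + ‖w‖)⁻¹) • u w‖) (fun n => ?_) ?_
      (fun n => Filter.Eventually.of_forall fun w => ?_) (Filter.Eventually.of_forall fun w => ?_)
    · exact h.locallyIntegrable_fun.aestronglyMeasurable.mul
        (hbc ((hχ n).mul hg)).aestronglyMeasurable
    · exact hu.norm.const_mul _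
    · have hs := sfac_pos w
      have hkw := hk w
      have hk1 : (1 + ‖w‖)⁻¹ ≤ 1 := inv_le_one_of_one_le₀ (by simp)
      have hsk : sfac w ≤ 4 * (1 + ‖w‖)⁻¹ := (sfac_le w).trans (by nlinarith)
      have b1 : ‖bracket τ g w‖ ≤ 8 * (A * B) * (sfac w * (1 + ‖w‖)⁻¹) := by
        refine (norm_bracket_le (by positivity) (hτb w) (hgb' w)).trans ?_
        have : A * B * sfac w * sfac w ≤ A * B * sfac w * (4 * (1 + ‖w‖)⁻¹) :=
          mul_le_mul_of_nonneg_left hsk (by positivity)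
        linarith
      have b2 : ‖bracket τ (χ n) w‖ ≤ 2 * (A * C) * (sfac w * (1 + ‖w‖)⁻¹) :=
        (norm_bracket_le (by positivity) (hτb w) (hC n w)).trans (le_of_eq (by ring))
      have b3 : ‖bracket τ (fun w => χ n w * g w) w‖ ≤
          (8 * (A * B) + 2 * (A * C) * B) * (sfac w * (1 + ‖w‖)⁻¹) := by
        rw [hprod]
        refine (norm_add_le _ _).trans ?_
        rw [norm_mul, norm_mul, add_mul]
        refine add_le_add ?_ ?_
        · exact (mul_le_mul (hχ1 n w) b1 (norm_nonneg _) zero_le_one).trans (by rw [one_mul])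
        · exact (mul_le_mul b2 (hgb w) (norm_nonneg _) (by positivity)).trans
            (le_of_eq (by ring))
      rw [norm_mul, norm_smul, Real.norm_of_nonneg (by positivity : 0 ≤ sfac w * (1 + ‖w‖)⁻¹)]
      calc ‖u w‖ * ‖bracket τ (fun w => χ n w * g w) w‖ ≤ ‖u w‖ * _ :=
            mul_le_mul_of_nonneg_left b3 (norm_nonneg _)
        _ = _ := by ring
    · refine tendsto_const_nhds.congr' ?_
      filter_upwards [hχlim w] with n hn
      rw [hprod, hn.1, one_mul]
      unfold bracket
      rw [hn.2 0, hn.2 1]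
      ring
  exact tendsto_nhds_unique (l1.congr key) l2.neg

/-! ### The representation on L² of the plane. -/

lemma integrable_inv_one_add_norm_pow (n : ℕ) (hn : 2 < n) :
    Integrable (fun w : Plane => ((1 + ‖w‖)⁻¹) ^ n) volume := by
  have h := integrable_one_add_norm (E := Plane) (μ := volume) (r := (n : ℝ)) (by
    rw [finrank_euclideanSpace_fin]; exact_mod_cast hn)
  refine h.congr (Filter.Eventually.of_forall fun w => ?_)
  simp only
  rw [Real.rpow_neg (by positivity), Real.rpow_natCast, inv_pow]

lemma continuous_inv_one_add_norm : Continuous fun w : Plane => (1 + ‖w‖)⁻¹ :=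
  (continuous_const.add continuous_norm).inv₀ fun w => (by positivity : 0 < 1 + ‖w‖).ne'

lemma integrable_sfac_sq : Integrable (fun w => sfac w ^ 2) volume := by
  refine ((integrable_inv_one_add_norm_pow 4 (by norm_num)).const_mul 16).mono'
    (contDiff_sfac.continuous.pow 2).aestronglyMeasurable (Filter.Eventually.of_forall fun w => ?_)
  rw [Real.norm_of_nonneg (by positivity)]
  have h := sfac_le w
  have h0 := sfac_pos w
  calc sfac w ^ 2 ≤ (4 * ((1 + ‖w‖)⁻¹) ^ 2) ^ 2 := by gcongr
    _ = _ := by ring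

lemma integrable_sfac_mul_inv : Integrable (fun w => sfac w * (1 + ‖w‖)⁻¹) volume := by
  refine ((integrable_inv_one_add_norm_pow 3 (by norm_num)).const_mul 4).mono'
    (contDiff_sfac.continuous.mul continuous_inv_one_add_norm).aestronglyMeasurable
    (Filter.Eventually.of_forall fun w => ?_)
  have h := sfac_le w
  have h0 := sfac_pos w
  rw [Real.norm_of_nonneg (by positivity)]
  calc sfac w * (1 + ‖w‖)⁻¹ ≤ (4 * ((1 + ‖w‖)⁻¹) ^ 2) * (1 + ‖w‖)⁻¹ := by gcongr
    _ = _ := by ring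

lemma memLp_sfac : MemLp sfac 2 volume :=
  (memLp_two_iff_integrable_sq contDiff_sfac.continuous.aestronglyMeasurable).mpr integrable_sfac_sq

lemma memLp_sfac_mul_sphereEval (i : Fin 3) (p : MvPolynomial (Fin 3) ℂ) :
    MemLp (fun w => (sfac w : ℂ) * sphereEval i w p) 2 volume := by
  obtain ⟨C, hC0, hC⟩ := exists_bound_sphereEval i p
  refine (memLp_sfac.const_mul C).mono ?_ (Filter.Eventually.of_forall fun w => ?_)
  · exact ((Complex.continuous_ofReal.comp contDiff_sfac.continuous).mul
      (contDiff_sphereEval i p).continuous).aestronglyMeasurable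
  · rw [norm_mul, norm_mul, Complex.norm_real, mul_comm, Real.norm_of_nonneg hC0]
    exact mul_le_mul_of_nonneg_right (hC w).1 (norm_nonneg _)

/-- The polynomials on the sphere as square integrable functions on the plane. -/
noncomputable def sphereRep (i : Fin 3) :
    MvPolynomial (Fin 3) ℂ →ₗ[ℂ] Lp ℂ 2 (volume : Measure Plane) where
  toFun p := (memLp_sfac_mul_sphereEval i p).toLp _
  map_add' p q := by
    rw [← MemLp.toLp_add]
    congr 1
    ext w
    simp only [map_add, Pi.add_apply]
    ring
  map_smul' c p := by
    rw [RingHom.id_apply, ← MemLp.toLp_const_smul]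
    congr 1
    ext w
    simp only [map_smul, Pi.smul_apply, smul_eq_mul]
    ring

lemma sphereRep_ae (i : Fin 3) (p : MvPolynomial (Fin 3) ℂ) :
    sphereRep i p =ᵐ[volume] fun w => (sfac w : ℂ) * sphereEval i w p :=
  (memLp_sfac_mul_sphereEval i p).coeFn_toLp

lemma isWeakGradC_of_contDiff {u : Plane → ℂ} (hu : ContDiff ℝ ∞ u) :
    IsWeakGradC u (fun j => pd j u) where
  locallyIntegrable_fun := hu.continuous.locallyIntegrable
  locallyIntegrable_grad j := (contDiff_pd hu j).continuous.locallyIntegrable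
  integral_eq φ hφ hc j := by
    refine integral_mul_fderiv_eq_neg_fderiv_mul_of_integrable ?_ ?_ ?_ ?_ ?_
    · exact ((contDiff_pd hu j).continuous.mul hφ.continuous).integrable_of_hasCompactSupport
        hc.mul_left
    · exact (hu.continuous.mul (contDiff_pd hφ j).continuous).integrable_of_hasCompactSupport
        (hc.pd_plane j).mul_left
    · exact (hu.continuous.mul hφ.continuous).integrable_of_hasCompactSupport hc.mul_left
    · exact fun w _ => hu.differentiableAt_plane w
    · exact fun w _ => hφ.differentiableAt_plane w

/-- The angular momenta of a weakly differentiable function, as functions on the plane. -/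
noncomputable def angMom (i : Fin 3) (D : Fin 2 → Plane → ℂ) (b : Fin 3) (w : Plane) : ℂ :=
  - Complex.I * (sfac w : ℂ)⁻¹ * weakBracket (xi i b) D w

lemma norm_angMom_le (i : Fin 3) (D : Fin 2 → Plane → ℂ) (b : Fin 3) (w : Plane) :
    ‖angMom i D b w‖ ≤ 2 * ‖D 1 w‖ + 2 * ‖D 0 w‖ := by
  have hs := sfac_pos w
  have h1 : ∀ j k, ‖pd j (xi i b) w * D k w‖ ≤ 2 * sfac w * ‖D k w‖ := by
    intro j k
    rw [norm_mul, pd_xi]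
    exact mul_le_mul_of_nonneg_right (norm_dxi_le i b j w) (norm_nonneg _)
  have h2 : ‖weakBracket (xi i b) D w‖ ≤ sfac w * (2 * ‖D 1 w‖ + 2 * ‖D 0 w‖) :=
    ((norm_sub_le _ _).trans (add_le_add (h1 0 1) (h1 1 0))).trans (le_of_eq (by ring))
  unfold angMom
  rw [norm_mul, norm_mul, norm_neg, Complex.norm_I, one_mul, norm_inv, Complex.norm_real,
    Real.norm_of_nonneg hs.le, inv_mul_le_iff₀ hs]
  exact h2

lemma memLp_angMom (i : Fin 3) {D : Fin 2 → Plane → ℂ} (hD : ∀ j, MemLp (D j) 2 volume)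
    (b : Fin 3) : MemLp (angMom i D b) 2 volume := by
  refine (((hD 1).norm.const_mul 2).add ((hD 0).norm.const_mul 2)).mono ?_
    (Filter.Eventually.of_forall fun w => ?_)
  · have hx : ∀ j, Continuous (pd j (xi i b)) := fun j => (contDiff_pd (contDiff_xi i b) j).continuous
    have hs : Continuous fun w => - Complex.I * (sfac w : ℂ)⁻¹ :=
      continuous_const.mul ((Complex.continuous_ofReal.comp contDiff_sfac.continuous).inv₀
        fun w => Complex.ofReal_ne_zero.mpr (sfac_pos w).ne')
    exact hs.aestronglyMeasurable.mul
      (((hx 0).aestronglyMeasurable.mul (hD 1).1).sub ((hx 1).aestronglyMeasurable.mul (hD 0).1))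
  · refine (norm_angMom_le i D b w).trans ?_
    simp only [Pi.add_apply]
    exact le_abs_self _

/-- Angular momenta of weakly differentiable functions in the sense of the representation. -/
lemma IsWeakGradC.isWeakLadder {u : Plane → ℂ} {D : Fin 2 → Plane → ℂ} (h : IsWeakGradC u D)
    (i : Fin 3) (hu : Integrable (fun w => (sfac w * (1 + ‖w‖)⁻¹) • u w) volume)
    (hu2 : MemLp (fun w => (sfac w : ℂ) * u w) 2 volume) (hD : ∀ j, MemLp (D j) 2 volume) :
    IsWeakLadder (sphereRep i) (hu2.toLp _) (fun b => (memLp_angMom i hD b).toLp _) := by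
  intro b p
  obtain ⟨C, hC0, hC⟩ := exists_bound_sphereEval i p
  have hcd := contDiff_sphereEval i p
  have hg : ContDiff ℝ ∞ fun w => (starRingEnd ℂ) (sphereEval i w p) :=
    (Complex.conjCLE : ℂ →L[ℝ] ℂ).contDiff.comp hcd
  have hDs : ∀ j, Integrable (fun w => sfac w • D j w) volume := fun j =>
    memLp_one_iff_integrable.mp ((hD j).smul (p := 2) (q := 2) (r := 1) memLp_sfac)
  have key := h.integral_weakBracket (contDiff_xi i b) hg zero_le_two hC0
    (fun w j => by rw [pd_xi]; exact norm_dxi_le i b j w)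
    (fun w => by rw [RCLike.norm_conj]; exact (hC w).1)
    (fun w j => by
      rw [pd_conj j (hcd.differentiableAt_plane w), RCLike.norm_conj]; exact (hC w).2 j) hu hDs
  have e1 : inner ℂ (sphereRep i p) ((memLp_angMom i hD b).toLp _) =
      ∫ w, - Complex.I * ((starRingEnd ℂ) (sphereEval i w p) * weakBracket (xi i b) D w) := by
    rw [L2.inner_def]
    refine integral_congr_ae ?_
    filter_upwards [sphereRep_ae i p, (memLp_angMom i hD b).coeFn_toLp] with w h1 h2
    rw [h1, h2, RCLike.inner_apply, map_mul, Complex.conj_ofReal, angMom]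
    have : (sfac w : ℂ) ≠ 0 := Complex.ofReal_ne_zero.mpr (sfac_pos w).ne'
    field_simp
  have e2 : inner ℂ (sphereRep i (ladder (ladderAdj b) p)) (hu2.toLp _) =
      ∫ w, Complex.I *
        (u w * bracket (xi i b) (fun w => (starRingEnd ℂ) (sphereEval i w p)) w) := by
    rw [L2.inner_def]
    refine integral_congr_ae ?_
    filter_upwards [sphereRep_ae i (ladder (ladderAdj b) p), hu2.coeFn_toLp] with w h1 h2
    rw [h1, h2, RCLike.inner_apply, map_mul, Complex.conj_ofReal, bracket_xi_conj_sphereEval]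
    linear_combination ((sfac w : ℂ) ^ 2 * u w *
      (starRingEnd ℂ) (sphereEval i w (ladder (ladderAdj b) p))) * Complex.I_sq
  rw [e1, e2, integral_const_mul, integral_const_mul, key]
  ring

lemma memLp_pd_sphereEval (i : Fin 3) (p : MvPolynomial (Fin 3) ℂ) (j : Fin 2) :
    MemLp (pd j fun w => sphereEval i w p) 2 volume := by
  obtain ⟨C, hC0, hC⟩ := exists_bound_sphereEval i p
  refine (memLp_sfac.const_mul C).mono
    (contDiff_pd (contDiff_sphereEval i p) j).continuous.aestronglyMeasurable
    (Filter.Eventually.of_forall fun w => ?_)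
  rw [norm_mul, Real.norm_of_nonneg hC0, Real.norm_of_nonneg (sfac_pos w).le]
  exact (hC w).2 j

/-- The weak statement `IsWeakGradC.isWeakLadder` applied to the smooth function given by `q`, whose
angular momenta are again polynomials on the sphere. -/
lemma sphereRep_adj (i b : Fin 3) (p q : MvPolynomial (Fin 3) ℂ) :
    inner ℂ (sphereRep i (ladder b p)) (sphereRep i q) =
      inner ℂ (sphereRep i p) (sphereRep i (ladder (ladderAdj b) q)) := by
  obtain ⟨C, hC0, hC⟩ := exists_bound_sphereEval i q
  have hcd := contDiff_sphereEval i q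
  have hu : Integrable (fun w => (sfac w * (1 + ‖w‖)⁻¹) • sphereEval i w q) volume := by
    refine (integrable_sfac_mul_inv.const_mul C).mono'
      ((contDiff_sfac.continuous.mul continuous_inv_one_add_norm).smul
        hcd.continuous).aestronglyMeasurable (Filter.Eventually.of_forall fun w => ?_)
    have hs := sfac_pos w
    rw [norm_smul, Real.norm_of_nonneg (by positivity), mul_comm C]
    exact mul_le_mul_of_nonneg_left (hC w).1 (by positivity)
  have h := (isWeakGradC_of_contDiff hcd).isWeakLadder i hu (memLp_sfac_mul_sphereEval i q)
    (memLp_pd_sphereEval i q) (ladderAdj b) p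
  rw [ladderAdj_ladderAdj] at h
  refine h.symm.trans ?_
  congr 1
  refine MemLp.toLp_congr _ (memLp_sfac_mul_sphereEval i _) (Filter.Eventually.of_forall fun w => ?_)
  have hb := bracket_xi_sphereEval i (ladderAdj b) q w
  have : (sfac w : ℂ) ≠ 0 := Complex.ofReal_ne_zero.mpr (sfac_pos w).ne'
  have hw : weakBracket (xi i (ladderAdj b)) (fun j => pd j fun w => sphereEval i w q) w =
    bracket (xi i (ladderAdj b)) (fun w => sphereEval i w q) w := rfl
  simp only [angMom]
  rw [hw, hb]
  field_simp
  rw [Complex.I_sq]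
  ring

/-! ### Totality of the polynomials. -/

lemma xi_injective (i : Fin 3) {v w : Plane} (h : ∀ b, xi i b v = xi i b w) : v = w := by
  have h0 := h 0
  have h1 := h 1
  have h2 := h 2
  simp only [xi, Matrix.cons_val] at h0 h1 h2
  have e1 : (stereoInv v (i + 1) : ℂ) = stereoInv w (i + 1) := by linear_combination (h0 + h1) / 2
  have e2 : (stereoInv v (i + 2) : ℂ) = stereoInv w (i + 2) := by
    linear_combination (-Complex.I / 2) * (h0 - h1) +
      ((stereoInv v (i + 2) : ℂ) - stereoInv w (i + 2)) * Complex.I_sq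
  rw [Complex.ofReal_inj] at e1 e2 h2
  have e : ∀ a, stereoInv v a = stereoInv w a := by
    intro a
    have ha : a = i ∨ a = i + 1 ∨ a = i + 2 := by
      clear * -
      revert a i
      decide
    rcases ha with rfl | rfl | rfl <;> assumption
  have s0 := e 0
  have s1 := e 1
  have s2 := e 2
  rw [stereoInv_zero, stereoInv_zero] at s0
  have hs : sfac v = sfac w := by linarith
  rw [stereoInv_one, stereoInv_one, hs] at s1
  rw [stereoInv_two, stereoInv_two, hs] at s2
  ext j
  fin_cases j
  · exact mul_left_cancel₀ (sfac_pos w).ne' s1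
  · exact mul_left_cancel₀ (sfac_pos w).ne' s2

open scoped BoundedContinuousFunction in
/-- Polynomials on the sphere as bounded continuous functions on the plane. -/
noncomputable def spherePolyBCF (i : Fin 3) : StarSubalgebra ℂ (Plane →ᵇ ℂ) where
  carrier := {F | ∃ p, ∀ w, F w = sphereEval i w p}
  mul_mem' := by
    rintro F G ⟨p, hp⟩ ⟨q, hq⟩
    exact ⟨p * q, fun w => by rw [BoundedContinuousFunction.mul_apply, hp, hq, map_mul]⟩
  add_mem' := by
    rintro F G ⟨p, hp⟩ ⟨q, hq⟩
    exact ⟨p + q, fun w => by rw [BoundedContinuousFunction.add_apply, hp, hq, map_add]⟩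
  algebraMap_mem' c := ⟨MvPolynomial.C c, fun w => by rw [sphereEval_C]; rfl⟩
  star_mem' := by
    rintro F ⟨p, hp⟩
    obtain ⟨q, hq⟩ := exists_conj_sphereEval i p
    exact ⟨q, fun w => by rw [hq, ← hp]; rfl⟩

lemma spherePolyBCF_separatesPoints (i : Fin 3) :
    ((spherePolyBCF i).map (BoundedContinuousFunction.toContinuousMapStarₐ ℂ)).SeparatesPoints := by
  intro v w hvw
  have : ∃ b, xi i b v ≠ xi i b w := by
    by_contra! h
    exact hvw (xi_injective i h)
  obtain ⟨b, hb⟩ := this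
  let F := BoundedContinuousFunction.ofNormedAddCommGroup (xi i b) (contDiff_xi i b).continuous 2
    (norm_xi_le i b)
  refine ⟨xi i b, ⟨F.toContinuousMap, ⟨F, ⟨MvPolynomial.X b, fun w => ?_⟩, rfl⟩, rfl⟩, hb⟩
  rw [sphereEval_X]
  rfl

/-- The positive and negative parts of `r` are densities of finite measures that agree on a
point-separating star algebra of bounded continuous functions. On a Polish space this makes the
measures equal. -/
lemma ae_eq_zero_of_real_moments (i : Fin 3) {r : Plane → ℝ} (hr : Integrable r volume)
    (h : ∀ p, ∫ w, sphereEval i w p * (r w : ℂ) = 0) : r =ᵐ[volume] 0 := by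
  have := isFiniteMeasure_withDensity_ofReal hr.2
  have := isFiniteMeasure_withDensity_ofReal hr.neg.2
  have hm : AEMeasurable (fun w => ENNReal.ofReal (r w)) volume :=
    hr.1.aemeasurable.ennreal_ofReal
  have hm' : AEMeasurable (fun w => ENNReal.ofReal ((-r) w)) volume :=
    hr.neg.1.aemeasurable.ennreal_ofReal
  have heq : volume.withDensity (fun w => ENNReal.ofReal (r w)) =
      volume.withDensity (fun w => ENNReal.ofReal ((-r) w)) := by
    refine ext_of_forall_mem_subalgebra_integral_eq_of_polish
      (spherePolyBCF_separatesPoints i) fun g hg => ?_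
    obtain ⟨p, hp⟩ := hg
    have hi : ∀ {r : Plane → ℝ}, Integrable r volume →
        Integrable (fun w => (ENNReal.ofReal (r w)).toReal • g w) volume := by
      intro r hr
      have h1 : Integrable (fun w => (ENNReal.ofReal (r w)).toReal) volume := by
        simpa only [ENNReal.toReal_ofReal'] using hr.pos_part
      refine (h1.norm.mul_const ‖g‖).mono' (h1.1.smul g.continuous.aestronglyMeasurable)
        (Filter.Eventually.of_forall fun w => ?_)
      rw [norm_smul]
      exact mul_le_mul_of_nonneg_left (g.norm_coe_le_norm w) (norm_nonneg _)
    rw [integral_withDensity_eq_integral_toReal_smul₀ hm (by simp),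
      integral_withDensity_eq_integral_toReal_smul₀ hm' (by simp), ← sub_eq_zero,
      ← integral_sub (hi hr) (hi hr.neg), ← h p]
    congr 1
    ext w
    rw [← sub_smul, ENNReal.toReal_ofReal', ENNReal.toReal_ofReal', hp, Pi.neg_apply,
      Complex.real_smul, mul_comm]
    congr 2
    rcases le_total 0 (r w) with h0 | h0
    · rw [max_eq_left h0, max_eq_right (by linarith), sub_zero]
    · rw [max_eq_right h0, max_eq_left (by linarith)]; ring
  have hfin : ∫⁻ w, ENNReal.ofReal (r w) ≠ ⊤ :=
    (hr.lintegral_lt_top).ne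
  have hae := (withDensity_eq_iff hm hm' hfin).mp heq
  filter_upwards [hae] with w hw
  have := congrArg ENNReal.toReal hw
  rw [ENNReal.toReal_ofReal', ENNReal.toReal_ofReal', Pi.neg_apply] at this
  rcases le_total 0 (r w) with h0 | h0
  · rw [max_eq_left h0, max_eq_right (by linarith)] at this
    exact this
  · rw [max_eq_right h0, max_eq_left (by linarith)] at this
    simp only [Pi.zero_apply]
    linarith

/-- The factor `sfac` makes `sfac w • x w` integrable; the polynomials are closed under conjugation,
so its real and imaginary parts have vanishing moments separately. -/
lemma sphereRep_total (i : Fin 3) (x : Lp ℂ 2 (volume : Measure Plane))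
    (h : ∀ p, inner ℂ (sphereRep i p) x = 0) : x = 0 := by
  set y : Plane → ℂ := fun w => sfac w • x w with hy
  have hyi : Integrable y volume :=
    memLp_one_iff_integrable.mp ((Lp.memLp x).smul (p := 2) (q := 2) (r := 1) memLp_sfac)
  have h1 : ∀ p, ∫ w, (starRingEnd ℂ) (sphereEval i w p) * y w = 0 := by
    intro p
    rw [← h p, L2.inner_def]
    refine integral_congr_ae ?_
    filter_upwards [sphereRep_ae i p] with w hw
    rw [hw, RCLike.inner_apply, map_mul, Complex.conj_ofReal, hy]
    simp only [Complex.real_smul]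
    ring
  have h2 : ∀ p, ∫ w, sphereEval i w p * y w = 0 := by
    intro p
    obtain ⟨q, hq⟩ := exists_conj_sphereEval i p
    rw [← h1 q]
    congr 1
    ext w
    rw [hq, Complex.conj_conj]
  have h3 : ∀ p, ∫ w, sphereEval i w p * (starRingEnd ℂ) (y w) = 0 := by
    intro p
    have := congrArg (starRingEnd ℂ) (h1 p)
    rw [← integral_conj, map_zero] at this
    simpa only [map_mul, Complex.conj_conj] using this
  have hint : ∀ p {z : Plane → ℂ}, Integrable z volume →
      Integrable (fun w => sphereEval i w p * z w) volume := by
    intro p z hz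
    obtain ⟨C, hC0, hC⟩ := exists_bound_sphereEval i p
    exact hz.bdd_mul (contDiff_sphereEval i p).continuous.aestronglyMeasurable
      (Filter.Eventually.of_forall fun w => (hC w).1)
  have hyc : Integrable (fun w => (starRingEnd ℂ) (y w)) volume :=
    (Complex.conjCLE : ℂ →L[ℝ] ℂ).integrable_comp hyi
  have hre := ae_eq_zero_of_real_moments i (r := fun w => (y w).re) hyi.re fun p => by
    have : ∀ w, sphereEval i w p * ((y w).re : ℂ) =
        (1 / 2 : ℂ) * (sphereEval i w p * y w + sphereEval i w p * (starRingEnd ℂ) (y w)) := by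
      intro w
      rw [Complex.re_eq_add_conj]
      ring
    simp_rw [this]
    rw [integral_const_mul, integral_add (hint p hyi) (hint p hyc), h2, h3]
    ring
  have him := ae_eq_zero_of_real_moments i (r := fun w => (y w).im) hyi.im fun p => by
    have : ∀ w, sphereEval i w p * ((y w).im : ℂ) = (1 / (2 * Complex.I)) *
        (sphereEval i w p * y w - sphereEval i w p * (starRingEnd ℂ) (y w)) := by
      intro w
      rw [Complex.im_eq_sub_conj]
      ring
    simp_rw [this]
    rw [integral_const_mul, integral_sub (hint p hyi) (hint p hyc), h2, h3]
    ring
  rw [Lp.eq_zero_iff_ae_eq_zero]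
  filter_upwards [hre, him] with w hw1 hw2
  have hy0 : y w = 0 := Complex.ext hw1 hw2
  exact (smul_eq_zero.mp hy0).resolve_left (sfac_pos w).ne'

lemma isSphereRep_sphereRep (i : Fin 3) : IsSphereRep (sphereRep i) where
  adj := sphereRep_adj i
  sphere p := by
    rw [← map_sub]
    refine MemLp.toLp_congr (memLp_sfac_mul_sphereEval i _) (memLp_sfac_mul_sphereEval i _)
      (Filter.Eventually.of_forall fun w => ?_)
    simp only
    rw [sphereEval_sphere, map_sub]
  total := sphereRep_total i

/-! ### Zero modes are not square integrable over the plane. -/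

section Decay

/-- The function behaves like 2/‖w‖ at infinity, so in polar coordinates its square diverges
logarithmically: the radial integrand exceeds 1/y for y > 1. -/
lemma not_memLp_sfac_mul_norm : ¬ MemLp (fun w : Plane => sfac w * ‖w‖) 2 volume := by
  intro h
  have h1 := h.integrable_sq
  have h2 : (fun w : Plane => (sfac w * ‖w‖) ^ 2) =
      fun w : Plane => (fun y : ℝ => (2 / (y ^ 2 + 1) * y) ^ 2) ‖w‖ := rfl
  rw [h2, integrable_fun_norm_addHaar (F := ℝ) (volume : Measure Plane)
    (f := fun y : ℝ => (2 / (y ^ 2 + 1) * y) ^ 2), finrank_euclideanSpace_fin] at h1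
  have h3 := h1.mono_set (Set.Ioi_subset_Ioi (zero_le_one' ℝ))
  refine not_integrableOn_Ioi_inv (a := 1) (h3.mono' ?_ ?_)
  · exact measurable_inv.aestronglyMeasurable
  · rw [ae_restrict_iff' measurableSet_Ioi]
    refine Filter.Eventually.of_forall fun y hy => ?_
    have hy1 : (1 : ℝ) < y := hy
    have hy0 : 0 < y := by linarith
    rw [norm_inv, Real.norm_of_nonneg hy0.le, smul_eq_mul, inv_le_iff_one_le_mul₀ hy0]
    have e : y ^ (2 - 1) * (2 / (y ^ 2 + 1) * y) ^ 2 * y = (2 * y ^ 2 / (y ^ 2 + 1)) ^ 2 := by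
      rw [show (2 - 1 : ℕ) = 1 from rfl, pow_one]
      field_simp
    rw [e]
    apply one_le_pow₀
    rw [le_div_iff₀ (by positivity)]
    nlinarith

/-- Swapping the coordinates is an isometry, so integrability for one coordinate would give it for
both and hence for the norm. -/
lemma not_memLp_sfac_mul_coord (a : Fin 2) : ¬ MemLp (fun w : Plane => sfac w * w a) 2 volume := by
  intro h
  let S : Plane ≃ₗᵢ[ℝ] Plane := LinearIsometryEquiv.piLpCongrLeft 2 ℝ ℝ (Equiv.swap 0 1)
  have hS : ∀ (w : Plane) (b : Fin 2), S w b = w (Equiv.swap 0 1 b) := by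
    intro w b
    simp [S, LinearIsometryEquiv.piLpCongrLeft_apply, Equiv.piCongrLeft'_apply]
  have hsS : ∀ w, sfac (S w) = sfac w := fun w => by unfold sfac; rw [S.norm_map]
  have h' : MemLp (fun w : Plane => sfac w * w (Equiv.swap 0 1 a)) 2 volume := by
    have := h.comp_measurePreserving S.measurePreserving
    refine this.congr_norm ?_ (Filter.Eventually.of_forall fun w => ?_)
    · exact (contDiff_sfac.continuous.mul (contDiff_coord _).continuous).aestronglyMeasurable
    · simp only [Function.comp_apply, hsS, hS]
  have hb : ∀ b, MemLp (fun w : Plane => sfac w * w b) 2 volume := by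
    intro b
    fin_cases a <;> fin_cases b <;> first | exact h | exact h'
  refine not_memLp_sfac_mul_norm (((hb 0).norm.add (hb 1).norm).mono ?_
    (Filter.Eventually.of_forall fun w => ?_))
  · exact (contDiff_sfac.continuous.mul continuous_norm).aestronglyMeasurable
  · have hs := sfac_pos w
    have hw : ‖w‖ ≤ |w 0| + |w 1| := by
      apply abs_le_of_sq_le_sq' _ (by positivity) |>.2
      rw [plane_norm_sq, ← sq_abs (w 0), ← sq_abs (w 1)]
      nlinarith [mul_nonneg (abs_nonneg (w 0)) (abs_nonneg (w 1))]
    simp only [Pi.add_apply]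
    rw [Real.norm_of_nonneg (by positivity), Real.norm_of_nonneg (by positivity), norm_mul,
      norm_mul, Real.norm_of_nonneg hs.le, ← mul_add]
    exact mul_le_mul_of_nonneg_left hw hs.le

/-- The even part under w ↦ -w is the constant `β`, which is not square integrable unless zero; the
odd part is then excluded by its slow decay. -/
lemma eq_zero_of_memLp_two_affine {β c : ℂ} {ℓ : Plane → ℂ} {a : Fin 2}
    (hodd : ∀ w, ℓ (-w) = - ℓ w) (hℓ : ∀ w, |w a| ≤ ‖ℓ w‖)
    (h : MemLp (fun w : Plane => β + c * ((sfac w : ℂ) * ℓ w)) 2 volume) : β = 0 ∧ c = 0 := by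
  have h' : MemLp (fun w : Plane => β - c * ((sfac w : ℂ) * ℓ w)) 2 volume := by
    have := h.comp_measurePreserving (LinearIsometryEquiv.neg ℝ (E := Plane)).measurePreserving
    refine this.ae_eq (Filter.Eventually.of_forall fun w => ?_)
    have hs : sfac (-w) = sfac w := by unfold sfac; rw [norm_neg]
    simp only [Function.comp_apply, LinearIsometryEquiv.coe_neg, hs, hodd]
    ring
  have hβ : MemLp (fun _ : Plane => β) 2 volume := by
    refine ((h.add h').const_mul (1 / 2)).ae_eq (Filter.Eventually.of_forall fun w => ?_)
    simp only [Pi.add_apply]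
    ring
  have hβ0 : β = 0 := by
    rw [memLp_const_iff (by simp) (by simp)] at hβ
    refine hβ.resolve_right ?_
    simp
  refine ⟨hβ0, ?_⟩
  by_contra hc
  have h1 : MemLp (fun w : Plane => (sfac w : ℂ) * ℓ w) 2 volume := by
    refine (h.const_mul c⁻¹).ae_eq (Filter.Eventually.of_forall fun w => ?_)
    simp only [hβ0, zero_add]
    rw [← mul_assoc, inv_mul_cancel₀ hc, one_mul]
  refine not_memLp_sfac_mul_coord a (h1.mono ?_ (Filter.Eventually.of_forall fun w => ?_))
  · exact (contDiff_sfac.continuous.mul (contDiff_coord _).continuous).aestronglyMeasurable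
  · rw [norm_mul, norm_mul, Complex.norm_real]
    exact mul_le_mul_of_nonneg_left (hℓ w) (norm_nonneg _)

/-- No nonzero combination of `1` and `x + iy` is square integrable over the plane. -/
lemma eq_zero_of_memLp_two_xi (i : Fin 3) {α c : ℂ}
    (h : MemLp (fun w => α + c * xi i 0 w) 2 volume) : α = 0 ∧ c = 0 := by
  have hs : MemLp (fun w => (sfac w : ℂ)) 2 volume := memLp_sfac.ofReal
  fin_cases i
  · refine eq_zero_of_memLp_two_affine (ℓ := fun w => (w 0 : ℂ) + Complex.I * w 1) (a := 0)
      (fun w => ?_) (fun w => ?_)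
      (h.ae_eq (Filter.Eventually.of_forall fun w => ?_))
    · simp; ring
    · simpa using Complex.abs_re_le_norm ((w 0 : ℂ) + Complex.I * w 1)
    · simp [xi, stereoInv_one, stereoInv_two]
      ring_nf
      simp
  -- When σ₀ = 1 - `sfac` enters x + iy, its value 1 at infinity is absorbed into `β`, and the
  -- `sfac` term is square integrable and can be added back.
  · have h2 := eq_zero_of_memLp_two_affine (β := α + c * Complex.I) (c := c)
      (ℓ := fun w => (w 1 : ℂ)) (a := 1) (fun w => ?_) (fun w => ?_)
      ((h.add (hs.const_mul (c * Complex.I))).ae_eq (Filter.Eventually.of_forall fun w => ?_))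
    · obtain ⟨h3, rfl⟩ := h2
      simpa using h3
    · simp
    · simp
    · simp [xi, stereoInv_zero, stereoInv_two]
      ring
  · have h2 := eq_zero_of_memLp_two_affine (β := α + c) (c := c)
      (ℓ := fun w => Complex.I * (w 0 : ℂ)) (a := 0)
      (fun w => ?_) (fun w => ?_)
      ((h.add (hs.const_mul c)).ae_eq (Filter.Eventually.of_forall fun w => ?_))
    · obtain ⟨h3, rfl⟩ := h2
      simpa using h3
    · simp
    · simp
    · simp [xi, stereoInv_zero, stereoInv_one]
      ring

end Decay

/-! ### From real functions to u = f - i h, and the energy identity. -/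

lemma MeasureTheory.LocallyIntegrable.coord {G : Plane → Plane}
    (hG : LocallyIntegrable G volume) (j : Fin 2) : LocallyIntegrable (fun w => G w j) volume := by
  intro w
  obtain ⟨s, hs, hi⟩ := hG w
  exact ⟨s, hs, (EuclideanSpace.proj (𝕜 := ℝ) j : Plane →L[ℝ] ℝ).integrable_comp hi⟩

lemma IsWeakGradient.integral_eq_complex {f : Plane → ℝ} {G : Plane → Plane}
    (h : IsWeakGradient f G) {φ : Plane → ℂ} (hφ : ContDiff ℝ ∞ φ) (hc : HasCompactSupport φ)
    (j : Fin 2) : ∫ w, (f w : ℂ) * pd j φ w = - ∫ w, (G w j : ℂ) * φ w := by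
  have hL : ∀ L : ℂ →L[ℝ] ℝ, ContDiff ℝ ∞ (fun w => L (φ w)) ∧
      HasCompactSupport (fun w => L (φ w)) := fun L =>
    ⟨L.contDiff.comp hφ, hc.comp_left (map_zero L)⟩
  have hGj := h.locallyIntegrable_grad.coord j
  have hpd : ∀ (L : ℂ →L[ℝ] ℝ) w, pd j (fun w => L (φ w)) w = L (pd j φ w) := fun L w =>
    pd_comp_clm j L (hφ.differentiableAt_plane w)
  have i1 : ∀ L : ℂ →L[ℝ] ℝ, Integrable (fun w => f w * L (pd j φ w)) volume := by
    intro L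
    have := h.locallyIntegrable_fun.integrable_smul_left_of_hasCompactSupport
      (L.continuous.comp (contDiff_pd hφ j).continuous) ((hc.pd_plane j).comp_left (map_zero L))
    simpa [mul_comm] using this
  have i2 : ∀ L : ℂ →L[ℝ] ℝ, Integrable (fun w => G w j * L (φ w)) volume := by
    intro L
    have := hGj.integrable_smul_left_of_hasCompactSupport
      (L.continuous.comp hφ.continuous) (hL L).2
    simpa [mul_comm] using this
  have e : ∀ L : ℂ →L[ℝ] ℝ, ∫ w, f w * L (pd j φ w) = - ∫ w, G w j * L (φ w) := by
    intro L
    rw [← h.integral_eq _ (hL L).1 (hL L).2 j]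
    congr 1
    ext w
    rw [← hpd]
    rfl
  have s1 : ∀ w, (f w : ℂ) * pd j φ w = ((f w * Complex.reCLM (pd j φ w) : ℝ) : ℂ) +
      Complex.I * ((f w * Complex.imCLM (pd j φ w) : ℝ) : ℂ) := by
    intro w
    conv_lhs => rw [← Complex.re_add_im (pd j φ w)]
    push_cast
    simp only [Complex.reCLM_apply, Complex.imCLM_apply]
    ring
  have s2 : ∀ w, (G w j : ℂ) * φ w = ((G w j * Complex.reCLM (φ w) : ℝ) : ℂ) +
      Complex.I * ((G w j * Complex.imCLM (φ w) : ℝ) : ℂ) := by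
    intro w
    conv_lhs => rw [← Complex.re_add_im (φ w)]
    push_cast
    simp only [Complex.reCLM_apply, Complex.imCLM_apply]
    ring
  simp_rw [s1, s2]
  rw [integral_add (i1 Complex.reCLM).ofReal ((i1 Complex.imCLM).ofReal.const_mul _),
    integral_add (i2 Complex.reCLM).ofReal ((i2 Complex.imCLM).ofReal.const_mul _),
    integral_const_mul, integral_const_mul, integral_complex_ofReal, integral_complex_ofReal, integral_complex_ofReal,
    integral_complex_ofReal, e, e]
  push_cast
  ring

lemma IsWeakGradient.isWeakGradC {f h : Plane → ℝ} {Df Dh : Plane → Plane}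
    (hf : IsWeakGradient f Df) (hh : IsWeakGradient h Dh) :
    IsWeakGradC (fun w => (f w : ℂ) - Complex.I * h w)
      (fun j w => (Df w j : ℂ) - Complex.I * Dh w j) := by
  have hloc : ∀ {f : Plane → ℝ}, LocallyIntegrable f volume →
      LocallyIntegrable (fun w => (f w : ℂ)) volume := by
    intro f hf w
    obtain ⟨s, hs, hi⟩ := hf w
    exact ⟨s, hs, hi.ofReal⟩
  have hf1 := hloc hf.locallyIntegrable_fun
  have hh1 := hloc hh.locallyIntegrable_fun
  have hf2 := fun j => hloc (hf.locallyIntegrable_grad.coord j)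
  have hh2 := fun j => hloc (hh.locallyIntegrable_grad.coord j)
  refine ⟨hf1.sub (hh1.smul Complex.I), fun j => (hf2 j).sub ((hh2 j).smul Complex.I),
    fun φ hφ hc j => ?_⟩
  have hpc := (contDiff_pd hφ j).continuous
  have hps := hc.pd_plane j
  have s1 : ∀ w, ((f w : ℂ) - Complex.I * h w) * pd j φ w =
      (f w : ℂ) * pd j φ w - Complex.I * ((h w : ℂ) * pd j φ w) := fun w => by ring
  have s2 : ∀ w, ((Df w j : ℂ) - Complex.I * Dh w j) * φ w =
      (Df w j : ℂ) * φ w - Complex.I * ((Dh w j : ℂ) * φ w) := fun w => by ring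
  simp_rw [s1, s2]
  rw [integral_sub (hf1.integrable_mul_of_hasCompactSupport hpc hps)
      ((hh1.integrable_mul_of_hasCompactSupport hpc hps).const_mul _),
    integral_sub ((hf2 j).integrable_mul_of_hasCompactSupport hφ.continuous hc)
      (((hh2 j).integrable_mul_of_hasCompactSupport hφ.continuous hc).const_mul _),
    integral_const_mul, integral_const_mul, hf.integral_eq_complex hφ hc,
    hh.integral_eq_complex hφ hc]
  ring

lemma inner_J₀ (v w : Plane) : ⟪J₀ v, w⟫ = v 0 * w 1 - v 1 * w 0 := by
  simp [J₀, PiLp.inner_apply, Fin.sum_univ_two]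
  ring

/-- The complex gradient of `f - i h`. -/
noncomputable def complexGrad (Df Dh : Plane → Plane) (j : Fin 2) (w : Plane) : ℂ :=
  (Df w j : ℂ) - Complex.I * Dh w j

/-- The difference comes from the bracket of σ_{i+1} and σ_{i+2}, the sum from conformality. Taking
f - i h rather than f + i h fixes the sign of the cross term. -/
lemma angMom_norm_sq (i : Fin 3) (Df Dh : Plane → Plane) (w : Plane) :
    (‖angMom i (complexGrad Df Dh) 0 w‖ ^ 2 - ‖angMom i (complexGrad Df Dh) 1 w‖ ^ 2 =
      -4 * (stereoInv w i * ⟪J₀ (Df w), Dh w⟫)) ∧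
    (‖angMom i (complexGrad Df Dh) 0 w‖ ^ 2 + ‖angMom i (complexGrad Df Dh) 1 w‖ ^ 2) / 2 +
      ‖angMom i (complexGrad Df Dh) 2 w‖ ^ 2 = ‖Df w‖ ^ 2 + ‖Dh w‖ ^ 2 := by
  have hs := (sfac_pos w).ne'
  have hn : ∀ b, ‖angMom i (complexGrad Df Dh) b w‖ ^ 2 =
      (sfac w ^ 2)⁻¹ * ‖weakBracket (xi i b) (complexGrad Df Dh) w‖ ^ 2 := by
    intro b
    rw [angMom, norm_mul, norm_mul, norm_neg, Complex.norm_I, one_mul, norm_inv,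
      Complex.norm_real, Real.norm_of_nonneg (sfac_pos w).le, mul_pow, inv_pow]
  have hsq : ∀ z : ℂ, ‖z‖ ^ 2 = z.re ^ 2 + z.im ^ 2 := fun z => by
    rw [← Complex.normSq_eq_norm_sq, Complex.normSq_apply]; ring
  obtain ⟨e1, e2, e3, e4⟩ := fin_three_add i
  have hb := dstereo_bracket (i + 1) w
  rw [e1, e2] at hb
  have hc : ∀ l m, dstereo i l w * dstereo i m w + dstereo (i + 1) l w * dstereo (i + 1) m w +
      dstereo (i + 2) l w * dstereo (i + 2) m w = if l = m then sfac w ^ 2 else 0 := by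
    intro l m
    rw [← dstereo_conformal, Fin.sum_univ_three]
    fin_cases i <;> simp <;> ring
  have c00 := hc 0 0
  have c01 := hc 0 1
  have c11 := hc 1 1
  simp only [if_true, Fin.zero_eq_one_iff, OfNat.ofNat_ne_one, if_false] at c00 c01 c11
  rw [inner_J₀, plane_norm_sq (Df w), plane_norm_sq (Dh w)]
  simp only [hn, hsq, weakBracket, pd_xi, dxi, complexGrad, Matrix.cons_val]
  simp only [Complex.sub_re, Complex.sub_im, Complex.add_re, Complex.add_im, Complex.mul_re,
    Complex.mul_im, Complex.I_re, Complex.I_im, Complex.ofReal_re, Complex.ofReal_im]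
  constructor
  · rw [← mul_sub, inv_mul_eq_iff_eq_mul₀ (pow_ne_zero 2 hs)]
    linear_combination (4 * (Df w 0 * Dh w 1 - Df w 1 * Dh w 0)) * hb
  · rw [← mul_add, mul_div_assoc, ← mul_add, inv_mul_eq_iff_eq_mul₀ (pow_ne_zero 2 hs)]
    linear_combination (Df w 1 ^ 2 + Dh w 1 ^ 2) * c00 + (Df w 0 ^ 2 + Dh w 0 ^ 2) * c11 -
      2 * (Df w 0 * Df w 1 + Dh w 0 * Dh w 1) * c01

lemma norm_toLp_sq {F : Plane → ℂ} (hF : MemLp F 2 volume) :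
    ‖hF.toLp F‖ ^ 2 = ∫ w, ‖F w‖ ^ 2 := by
  have h : ((‖hF.toLp F‖ ^ 2 : ℝ) : ℂ) = ((∫ w, ‖F w‖ ^ 2 : ℝ) : ℂ) := by
    have h1 : ((‖hF.toLp F‖ ^ 2 : ℝ) : ℂ) = inner ℂ (hF.toLp F) (hF.toLp F) := by
      rw [inner_self_eq_norm_sq_to_K]; push_cast; rfl
    rw [h1, L2.inner_def, ← integral_complex_ofReal]
    refine integral_congr_ae ?_
    filter_upwards [hF.coeFn_toLp] with w hw
    rw [hw, inner_self_eq_norm_sq_to_K]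
    push_cast
    rfl
  exact_mod_cast h

/-- The energy inequality with its equality case. -/
lemma four_integral_le_energy (i : Fin 3) {f h : Plane → ℝ} {Df Dh : Plane → Plane}
    (hf : MemLp f 2 volume) (hh : MemLp h 2 volume) (hDf : IsWeakGradient f Df)
    (hDh : IsWeakGradient h Dh) (hDf2 : MemLp Df 2 volume) (hDh2 : MemLp Dh 2 volume) :
    4 * ∫ w, stereoInv w i * ⟪J₀ (Df w), Dh w⟫ ≤ (∫ w, ‖Df w‖ ^ 2) + (∫ w, ‖Dh w‖ ^ 2) ∧
    (4 * ∫ w, stereoInv w i * ⟪J₀ (Df w), Dh w⟫ = (∫ w, ‖Df w‖ ^ 2) + (∫ w, ‖Dh w‖ ^ 2) →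
      f =ᵐ[volume] 0 ∧ h =ᵐ[volume] 0) := by
  set u : Plane → ℂ := fun w => (f w : ℂ) - Complex.I * h w with hu
  have hw : IsWeakGradC u (complexGrad Df Dh) := hDf.isWeakGradC hDh
  have hu2 : MemLp u 2 volume := hf.ofReal.sub (hh.ofReal.const_mul Complex.I)
  have hcomp : ∀ {G : Plane → Plane}, MemLp G 2 volume → ∀ j, MemLp (fun w => (G w j : ℂ)) 2 volume :=
    fun hG j => ((EuclideanSpace.proj (𝕜 := ℝ) j : Plane →L[ℝ] ℝ).comp_memLp' hG).ofReal
  have hD : ∀ j, MemLp (complexGrad Df Dh j) 2 volume := fun j =>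
    (hcomp hDf2 j).sub ((hcomp hDh2 j).const_mul Complex.I)
  have hsu : MemLp (fun w => (sfac w : ℂ) * u w) 2 volume := by
    refine (hu2.norm.const_mul 4).mono ?_ (Filter.Eventually.of_forall fun w => ?_)
    · exact (Complex.continuous_ofReal.comp contDiff_sfac.continuous).aestronglyMeasurable.mul hu2.1
    · have hs : sfac w ≤ 4 := (sfac_le w).trans (by
        have : ((1 + ‖w‖)⁻¹) ^ 2 ≤ 1 := pow_le_one₀ (by positivity)
          (inv_le_one_of_one_le₀ (by simp))
        linarith)
      rw [norm_mul, norm_mul, Complex.norm_real, Real.norm_of_nonneg (sfac_pos w).le, norm_norm,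
        Real.norm_of_nonneg (by norm_num)]
      exact mul_le_mul_of_nonneg_right hs (norm_nonneg _)
  have hsku : Integrable (fun w => (sfac w * (1 + ‖w‖)⁻¹) • u w) volume := by
    refine (memLp_one_iff_integrable.mp (hu2.norm.smul (p := 2) (q := 2) (r := 1)
      memLp_sfac)).mono' ?_ (Filter.Eventually.of_forall fun w => ?_)
    · exact (contDiff_sfac.continuous.mul
        continuous_inv_one_add_norm).aestronglyMeasurable.smul hu2.1
    · have hs := sfac_pos w
      rw [norm_smul, Real.norm_of_nonneg (by positivity)]
      exact mul_le_mul_of_nonneg_right (mul_le_of_le_one_right hs.le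
        (inv_le_one_of_one_le₀ (by simp))) (norm_nonneg _)
  have he := isSphereRep_sphereRep i
  have hlad := hw.isWeakLadder i hsku hsu hD
  set U := hsu.toLp _ with hU
  set a : Fin 3 → Lp ℂ 2 (volume : Measure Plane) := fun b => (memLp_angMom i hD b).toLp _ with ha
  have hna : ∀ b, ‖a b‖ ^ 2 = ∫ w, ‖angMom i (complexGrad Df Dh) b w‖ ^ 2 := fun b =>
    norm_toLp_sq _
  have hia : ∀ b, Integrable (fun w => ‖angMom i (complexGrad Df Dh) b w‖ ^ 2) volume := fun b =>
    (memLp_angMom i hD b).norm.integrable_sq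
  have hi1 : ‖a 0‖ ^ 2 - ‖a 1‖ ^ 2 = -4 * ∫ w, stereoInv w i * ⟪J₀ (Df w), Dh w⟫ := by
    rw [hna, hna, ← integral_sub (hia 0) (hia 1), ← integral_const_mul]
    congr 1
    ext w
    exact (angMom_norm_sq i Df Dh w).1
  have hi2 : (‖a 0‖ ^ 2 + ‖a 1‖ ^ 2) / 2 + ‖a 2‖ ^ 2 =
      (∫ w, ‖Df w‖ ^ 2) + (∫ w, ‖Dh w‖ ^ 2) := by
    have hi01 : Integrable (fun w => (‖angMom i (complexGrad Df Dh) 0 w‖ ^ 2 +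
        ‖angMom i (complexGrad Df Dh) 1 w‖ ^ 2) / 2) volume := ((hia 0).add (hia 1)).div_const 2
    rw [hna, hna, hna, ← integral_add (hia 0) (hia 1), ← integral_div, ← integral_add hi01 (hia 2),
      ← integral_add hDf2.norm.integrable_sq hDh2.norm.integrable_sq]
    congr 1
    ext w
    exact (angMom_norm_sq i Df Dh w).2
  have hi3 := he.norm_sq_sub hlad
  have hi4 := he.re_inner_nonneg hlad
  have hi5 : (inner ℂ (a 2 - U) (a 2)).re = ‖a 2‖ ^ 2 - (inner ℂ U (a 2)).re := by
    rw [inner_sub_left, Complex.sub_re, ← inner_self_eq_norm_sq (𝕜 := ℂ)]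
    rfl
  -- The deficit is a sum of two nonnegative terms; half of ‖a 0‖² - ‖a 1‖² is traded for -Re⟨U, a
  -- 2⟩ by the commutator identity.
  have hid : (∫ w, ‖Df w‖ ^ 2) + (∫ w, ‖Dh w‖ ^ 2) - 4 * ∫ w, stereoInv w i * ⟪J₀ (Df w), Dh w⟫ =
      ‖a 0‖ ^ 2 + (inner ℂ (a 2 - U) (a 2)).re := by
    rw [hi5]
    linarith
  have hn0 : 0 ≤ ‖a 0‖ ^ 2 := by positivity
  refine ⟨by linarith, fun heq => ?_⟩
  have h0 : (inner ℂ (a 2 - U) (a 2)).re = 0 := by linarith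
  have ha0 : a 0 = 0 := by
    have : ‖a 0‖ ^ 2 = 0 := by linarith
    exact norm_eq_zero.mp (pow_eq_zero_iff two_ne_zero |>.mp this)
  obtain ⟨α, c, hαc⟩ := he.exists_eq_of_raising_eq_zero hlad h0 ha0
  have hae : u =ᵐ[volume] fun w => α + c * xi i 0 w := by
    have h1 := hsu.coeFn_toLp
    rw [← hU, hαc] at h1
    filter_upwards [h1, sphereRep_ae i (MvPolynomial.C α + MvPolynomial.C c * MvPolynomial.X 0)]
      with w h2 h3
    rw [h2, map_add, map_mul, sphereEval_C, sphereEval_C, sphereEval_X] at h3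
    exact mul_left_cancel₀ (Complex.ofReal_ne_zero.mpr (sfac_pos w).ne') h3
  -- Here square integrability of `u` itself is used, without the factor `sfac`.
  obtain ⟨rfl, rfl⟩ := eq_zero_of_memLp_two_xi i (hu2.ae_eq hae)
  constructor
  · filter_upwards [hae] with w hw
    simpa [hu] using congrArg Complex.re hw
  · filter_upwards [hae] with w hw
    simpa [hu] using congrArg Complex.im hw

/-! ### Uniqueness of weak gradients, degenerate cases and rescaling. -/

/-- Weak gradients are unique. -/
lemma IsWeakGradient.ae_eq {f f' : Plane → ℝ} {G G' : Plane → Plane} (h : IsWeakGradient f G)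
    (h' : IsWeakGradient f' G') (hff' : f =ᵐ[volume] f') : G =ᵐ[volume] G' := by
  have hj : ∀ j, ∀ᵐ w, G w j = G' w j := by
    intro j
    refine ae_eq_of_integral_contDiff_smul_eq (h.locallyIntegrable_grad.coord j)
      (h'.locallyIntegrable_grad.coord j) fun φ hφ hc => ?_
    have h1 := h.integral_eq φ hφ hc j
    have h2 := h'.integral_eq φ hφ hc j
    have h3 : ∫ w, f w * fderiv ℝ φ w (EuclideanSpace.single j 1) =
        ∫ w, f' w * fderiv ℝ φ w (EuclideanSpace.single j 1) := by
      refine integral_congr_ae ?_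
      filter_upwards [hff'] with w hw
      rw [hw]
    rw [h1, h2, neg_inj] at h3
    simpa only [smul_eq_mul, mul_comm] using h3
  filter_upwards [hj 0, hj 1] with w h0 h1
  ext j
  fin_cases j
  · exact h0
  · exact h1

lemma IsWeakGradient.const_smul {f : Plane → ℝ} {G : Plane → Plane} (h : IsWeakGradient f G)
    (c : ℝ) : IsWeakGradient (fun w => c * f w) (fun w => c • G w) where
  locallyIntegrable_fun := h.locallyIntegrable_fun.smul c
  locallyIntegrable_grad := h.locallyIntegrable_grad.smul c
  integral_eq φ hφ hc j := by
    simp only [PiLp.smul_apply, smul_eq_mul, mul_assoc]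
    rw [integral_const_mul, integral_const_mul, h.integral_eq φ hφ hc j, mul_neg]

lemma isWeakGradient_zero : IsWeakGradient (fun _ => 0) (fun _ => 0) where
  locallyIntegrable_fun := continuous_const.locallyIntegrable
  locallyIntegrable_grad := continuous_const.locallyIntegrable
  integral_eq φ _ _ j := by simp

lemma normL2_sq {G : Plane → Plane} (hG : MemLp G 2 volume) :
    normL2 G ^ 2 = ∫ w, ‖G w‖ ^ 2 := by
  have h := hG.eLpNorm_eq_integral_rpow_norm two_ne_zero ENNReal.ofNat_ne_top
  have h0 : 0 ≤ ∫ w, ‖G w‖ ^ 2 := integral_nonneg fun w => by positivity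
  unfold normL2
  rw [h, ENNReal.toReal_ofReal (by positivity)]
  simp only [ENNReal.toReal_ofNat, Real.rpow_ofNat]
  rw [← Real.rpow_natCast, ← Real.rpow_mul h0]
  norm_num

lemma MemH1.memLp_of_isWeakGradient {f : Plane → ℝ} (hf : MemH1 f) {Df : Plane → Plane}
    (hDf : IsWeakGradient f Df) : MemLp Df 2 volume := by
  obtain ⟨G, hG, hG2⟩ := hf.2
  exact hG2.ae_eq (hG.ae_eq hDf (Filter.EventuallyEq.refl _ _))

lemma norm_J₀ (v : Plane) : ‖J₀ v‖ = ‖v‖ := by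
  have h : ‖J₀ v‖ ^ 2 = ‖v‖ ^ 2 := by
    rw [plane_norm_sq, plane_norm_sq]
    simp [J₀]
    ring
  exact (pow_left_inj₀ (norm_nonneg _) (norm_nonneg _) two_ne_zero).mp h

lemma continuous_J₀ : Continuous J₀ := by
  unfold J₀
  fun_prop

lemma integrable_stereoInv_mul_inner (i : Fin 3) {Df Dh : Plane → Plane}
    (hDf : MemLp Df 2 volume) (hDh : MemLp Dh 2 volume) :
    Integrable (fun w : Plane => stereoInv w i * ⟪J₀ (Df w), Dh w⟫) volume := by
  have hi : Integrable (fun w => ‖Df w‖ * ‖Dh w‖) volume := hDf.norm.integrable_mul hDh.norm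
  refine hi.mono' ?_ (Filter.Eventually.of_forall fun w => ?_)
  · exact (contDiff_stereoInv i).continuous.aestronglyMeasurable.mul
      ((continuous_J₀.comp_aestronglyMeasurable hDf.1).inner hDh.1)
  · rw [norm_mul, ← norm_J₀ (Df w)]
    exact (mul_le_of_le_one_left (norm_nonneg _) (abs_stereoInv_le i w)).trans
      (norm_inner_le_norm _ _)

/-- The equality case of the energy inequality with second function zero: both sides are then 0. -/
lemma eq_zero_of_normL2_eq_zero {f : Plane → ℝ} (hf : MemLp f 2 volume) {Df : Plane → Plane}
    (hDf : IsWeakGradient f Df) (hDf2 : MemLp Df 2 volume) (h : normL2 Df = 0) :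
    f =ᵐ[volume] 0 := by
  refine ((four_integral_le_energy 0 hf MemLp.zero' hDf isWeakGradient_zero hDf2
    MemLp.zero').2 ?_).1
  rw [← normL2_sq hDf2, h]
  simp

lemma integral_eq_zero_of_ae_eq_zero_left (i : Fin 3) {Df Dh : Plane → Plane}
    (h : Df =ᵐ[volume] fun _ => 0) :
    ∫ w, stereoInv w i * ⟪J₀ (Df w), Dh w⟫ = 0 := by
  refine integral_eq_zero_of_ae ?_
  filter_upwards [h] with w hw
  rw [inner_J₀, hw]
  simp

lemma integral_eq_zero_of_ae_eq_zero_right (i : Fin 3) {Df Dh : Plane → Plane}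
    (h : Dh =ᵐ[volume] fun _ => 0) :
    ∫ w, stereoInv w i * ⟪J₀ (Df w), Dh w⟫ = 0 := by
  refine integral_eq_zero_of_ae ?_
  filter_upwards [h] with w hw
  rw [hw]
  simp

lemma normL2_eq_zero {G : Plane → Plane} (h : G =ᵐ[volume] fun _ => 0) : normL2 G = 0 := by
  unfold normL2
  rw [eLpNorm_congr_ae h]
  simp

/-- The integral is unchanged under (f, h) ↦ (t f, t⁻¹ h), whereas the energy becomes t²A² + t⁻²B².
Its minimum 2AB is attained at t² = B/A, which requires A and B to be positive. -/
lemma two_integral_le_mul (i : Fin 3) {f h : Plane → ℝ} {Df Dh : Plane → Plane}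
    (hf : MemLp f 2 volume) (hh : MemLp h 2 volume) (hDf : IsWeakGradient f Df)
    (hDh : IsWeakGradient h Dh) (hDf2 : MemLp Df 2 volume) (hDh2 : MemLp Dh 2 volume)
    (hA : 0 < normL2 Df) (hB : 0 < normL2 Dh) :
    2 * ∫ w, stereoInv w i * ⟪J₀ (Df w), Dh w⟫ ≤ normL2 Df * normL2 Dh ∧
    (2 * ∫ w, stereoInv w i * ⟪J₀ (Df w), Dh w⟫ = normL2 Df * normL2 Dh →
      f =ᵐ[volume] 0) := by
  set A := normL2 Df with hAdef
  set B := normL2 Dh with hBdef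
  set t : ℝ := √(B / A) with ht
  have ht2 : t ^ 2 = B / A := Real.sq_sqrt (by positivity)
  have ht0 : t ≠ 0 := (Real.sqrt_pos.mpr (by positivity)).ne'
  have key := four_integral_le_energy i (hf.const_mul t) (hh.const_mul t⁻¹) (hDf.const_smul t)
    (hDh.const_smul t⁻¹) (hDf2.const_smul t) (hDh2.const_smul t⁻¹)
  have e1 : ∫ w, stereoInv w i * ⟪J₀ (t • Df w), t⁻¹ • Dh w⟫ =
      ∫ w, stereoInv w i * ⟪J₀ (Df w), Dh w⟫ := by
    congr 1
    ext w
    rw [inner_J₀, inner_J₀]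
    simp only [PiLp.smul_apply, smul_eq_mul]
    field_simp
  have e2 : ∀ (c : ℝ) {G : Plane → Plane}, MemLp G 2 volume →
      ∫ w, ‖c • G w‖ ^ 2 = c ^ 2 * normL2 G ^ 2 := by
    intro c G hG
    rw [normL2_sq hG, ← integral_const_mul]
    congr 1
    ext w
    rw [norm_smul, mul_pow, Real.norm_eq_abs, sq_abs]
  rw [e1, e2 t hDf2, e2 t⁻¹ hDh2, inv_pow, ht2, ← hAdef, ← hBdef] at key
  have e3 : B / A * A ^ 2 + (B / A)⁻¹ * B ^ 2 = 2 * (A * B) := by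
    field_simp
    ring
  rw [e3] at key
  refine ⟨by linarith [key.1], fun heq => ?_⟩
  have hz := (key.2 (by linarith)).1
  filter_upwards [hz] with w hw
  exact (mul_eq_zero.mp hw).resolve_left ht0

theorem corollary1p1 (f h : Plane → ℝ) (hf : MemH1 f) (hh : MemH1 h)
    (Df Dh : Plane → Plane) (hDf : IsWeakGradient f Df) (hDh : IsWeakGradient h Dh) (i : Fin 3) :
    (MemLp Df 2 volume ∧ MemLp Dh 2 volume ∧
      Integrable (fun w : Plane => stereoInv w i * ⟪J₀ (Df w), Dh w⟫) volume) ∧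
    2 * ∫ w : Plane, stereoInv w i * ⟪J₀ (Df w), Dh w⟫ ≤ normL2 Df * normL2 Dh ∧
    (2 * ∫ w : Plane, stereoInv w i * ⟪J₀ (Df w), Dh w⟫ = normL2 Df * normL2 Dh ↔
      f =ᵐ[volume] 0 ∨ h =ᵐ[volume] 0) := by
  have hDf2 := hf.memLp_of_isWeakGradient hDf
  have hDh2 := hh.memLp_of_isWeakGradient hDh
  refine ⟨⟨hDf2, hDh2, integrable_stereoInv_mul_inner i hDf2 hDh2⟩, ?_⟩
  have hconv : f =ᵐ[volume] 0 ∨ h =ᵐ[volume] 0 →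
      2 * ∫ w : Plane, stereoInv w i * ⟪J₀ (Df w), Dh w⟫ = normL2 Df * normL2 Dh := by
    rintro (h0 | h0)
    · have hz := hDf.ae_eq isWeakGradient_zero h0
      rw [integral_eq_zero_of_ae_eq_zero_left i hz, normL2_eq_zero hz]
      ring
    · have hz := hDh.ae_eq isWeakGradient_zero h0
      rw [integral_eq_zero_of_ae_eq_zero_right i hz, normL2_eq_zero hz]
      ring
  -- If a gradient norm vanishes, rescaling is impossible, but the function itself is zero and
  -- equality holds trivially.
  rcases (ENNReal.toReal_nonneg : 0 ≤ normL2 Df).eq_or_lt with hA | hA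
  · have h0 : f =ᵐ[volume] 0 ∨ h =ᵐ[volume] 0 :=
      Or.inl (eq_zero_of_normL2_eq_zero hf.1 hDf hDf2 hA.symm)
    exact ⟨(hconv h0).le, fun _ => h0, hconv⟩
  rcases (ENNReal.toReal_nonneg : 0 ≤ normL2 Dh).eq_or_lt with hB | hB
  · have h0 : f =ᵐ[volume] 0 ∨ h =ᵐ[volume] 0 :=
      Or.inr (eq_zero_of_normL2_eq_zero hh.1 hDh hDh2 hB.symm)
    exact ⟨(hconv h0).le, fun _ => h0, hconv⟩
  have key := two_integral_le_mul i hf.1 hh.1 hDf hDh hDf2 hDh2 hA hB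
  exact ⟨key.1, fun heq => Or.inl (key.2 heq), hconv⟩
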